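/- Let $\rho$ be a two-qubit state, i.e. a positive semidefinite operator of trace one on $\mathbb C^2\otimes\mathbb C^2$, and let $\omega$ be a real number with $0.85798\le\omega\le 1$. For a unit vector $|\varphi\rangle\in\mathbb C^2\otimes\mathbb C^2$ with reduced state $\rho_A=\mathrm{tr}_B|\varphi\rangle\langle\varphi|$, put $\mathfrak C_\omega(|\varphi\rangle)=\bigl[\mathrm{tr}(\rho_A^{\omega})-1\bigr]^{\omega}$, and define the $G_\omega$-concurrence of $\rho$ by the convex roof $$\mathfrak C_\omega(\rho)=\min_{\{p_i,|\varphi_i\rangle\}}\sum_i p_i\,\mathfrak C_\omega(|\varphi_i\rangle),$$ over all finite decompositions $\rho=\sum_i p_i|\varphi_i\rangle\langle\varphi_i|$ with $p_i\ge 0$, $\sum_i p_i=1$ and unit vectors $|\varphi_i\rangle$. Let $C(\rho)=\max\{0,\lambda_1-\lambda_2-\lambda_3-\lambda_4\}$ be Wootters' concurrence, where $\lambda_1\ge\lambda_2\ge\lambda_3\ge\lambda_4\ge 0$ are the square roots of the eigenvalues, counted with multiplicity, of $\rho\,(\sigma_y\otimes\sigma_y)\rho^{*}(\sigma_y\otimes\sigma_y)$,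 with $\rho^*$ the entrywise complex conjugate of $\rho$ in the standard product basis and $\sigma_y=\begin{pmatrix}0&-i\\ i&0\end{pmatrix}$. For $0\le\theta\le1$ let $$h_\omega(\theta)=\left[\left(\frac{1+\sqrt{1-\theta^2}}2\right)^{\omega}+\left(\frac{1-\sqrt{1-\theta^2}}2\right)^{\omega}-1\right]^{\omega}.$$ Then $0\le C(\rho)\le 1$, the minimum defining $\mathfrak C_\omega(\rho)$ is attained, and $$\mathfrak C_\omega(\rho)=h_\omega\bigl(C(\rho)\bigr).$$ -/

import Mathlib

open scoped Matrix Kronecker ComplexOrder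

noncomputable section

/-- Pure state vectors `|φ⟩ ∈ ℂ^a ⊗ ℂ^b`, written in the product basis. -/
abbrev Ket (a b : Type) := EuclideanSpace ℂ (a × b)

/-- The rank-one operator `|φ⟩⟨φ|`. -/
def ketBra {a b : Type} (φ : Ket a b) : Matrix (a × b) (a × b) ℂ :=
  Matrix.of fun x y => φ x * star (φ y)

/-- Density matrices: positive semidefinite with trace one. -/
def IsDensityMatrix {n : Type} [Fintype n] (ρ : Matrix n n ℂ) : Prop :=
  ρ.PosSemidef ∧ ρ.trace = 1

/-- The partial trace over the second tensor factor. -/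
def partialTraceRight {a b : Type} [Fintype b] (ρ : Matrix (a × b) (a × b) ℂ) :
    Matrix a a ℂ :=
  Matrix.of fun i i' => ∑ j : b, ρ (i, j) (i', j)

/-- `tr (σ ^ ω)`, with the power taken in the continuous functional calculus of the Hermitian
matrix `σ`. -/
def traceRpow {a : Type} [Fintype a] [DecidableEq a] (ω : ℝ) (σ : Matrix a a ℂ) : ℝ :=
  (Matrix.trace (cfc (fun x : ℝ => x ^ ω) σ)).re

/-- The `G_ω`-concurrence of a pure state, `(tr (ρ_A ^ ω) - 1) ^ ω`. -/
def gConcurrencePure {a b : Type} [Fintype a] [DecidableEq a] [Fintype b]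
    (ω : ℝ) (φ : Ket a b) : ℝ :=
  (traceRpow ω (partialTraceRight (ketBra φ)) - 1) ^ ω

/-- `(p, φ)` is a pure-state decomposition `ρ = ∑ i, p i |φ i⟩⟨φ i|` with `n` terms. -/
def IsPureDecomposition {a b : Type} [Fintype a] [Fintype b] {n : ℕ}
    (ρ : Matrix (a × b) (a × b) ℂ) (p : Fin n → ℝ) (φ : Fin n → Ket a b) : Prop :=
  (∀ i, 0 ≤ p i) ∧ ∑ i, p i = 1 ∧ (∀ i, ‖φ i‖ = 1) ∧ ρ = ∑ i, (p i : ℂ) • ketBra (φ i)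

/-- The values `∑ i, p i * 𝔠_ω(φ i)` over all finite pure-state decompositions of `ρ`. -/
def gConcurrenceValues {a b : Type} [Fintype a] [DecidableEq a] [Fintype b]
    (ω : ℝ) (ρ : Matrix (a × b) (a × b) ℂ) : Set ℝ :=
  {v | ∃ (n : ℕ) (p : Fin n → ℝ) (φ : Fin n → Ket a b),
    IsPureDecomposition ρ p φ ∧ v = ∑ i, p i * gConcurrencePure ω (φ i)}

/-- The `G_ω`-concurrence of a mixed state: the convex roof of the pure-state quantity. -/
def gConcurrence {a b : Type} [Fintype a] [DecidableEq a] [Fintype b]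
    (ω : ℝ) (ρ : Matrix (a × b) (a × b) ℂ) : ℝ :=
  sInf (gConcurrenceValues ω ρ)

/-- The Pauli matrix `σ_y`. -/
def pauliY : Matrix (Fin 2) (Fin 2) ℂ := !![0, -Complex.I; Complex.I, 0]

/-- The spin-flipped matrix `(σ_y ⊗ σ_y) ρ* (σ_y ⊗ σ_y)`, where `ρ*` is the entrywise complex
conjugate in the product basis. -/
def spinFlip (ρ : Matrix (Fin 2 × Fin 2) (Fin 2 × Fin 2) ℂ) :
    Matrix (Fin 2 × Fin 2) (Fin 2 × Fin 2) ℂ :=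
  (pauliY ⊗ₖ pauliY) * ρ.map star * (pauliY ⊗ₖ pauliY)

/-- The square roots of the eigenvalues of `ρ * spinFlip ρ`, with algebraic multiplicity, in
decreasing order (for a density matrix `ρ` these eigenvalues are real and nonnegative). -/
def woottersSpectrum (ρ : Matrix (Fin 2 × Fin 2) (Fin 2 × Fin 2) ℂ) : List ℝ :=
  ((ρ * spinFlip ρ).charpoly.roots.map fun z => Real.sqrt z.re).sort (· ≥ ·)

/-- Wootters' concurrence `max {0, l₁ - l₂ - l₃ - l₄}`; the list has length four. -/
def concurrence (ρ : Matrix (Fin 2 × Fin 2) (Fin 2 × Fin 2) ℂ) : ℝ :=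
  max 0 ((woottersSpectrum ρ).getD 0 0 - (woottersSpectrum ρ).getD 1 0
    - (woottersSpectrum ρ).getD 2 0 - (woottersSpectrum ρ).getD 3 0)

/-- The function `h_ω(θ)`, for `0 ≤ θ ≤ 1`. -/
def hFun (ω θ : ℝ) : ℝ :=
  (((1 + Real.sqrt (1 - θ ^ 2)) / 2) ^ ω + ((1 - Real.sqrt (1 - θ ^ 2)) / 2) ^ ω - 1) ^ ω

end

noncomputable section

open Filter Topology

/-- The binomial series for `(1 + x) ^ a`. -/
theorem hasSum_one_add_rpow (a : ℝ) {x : ℝ} (hx : |x| < 1) :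
    HasSum (fun n => Ring.choose a n * x ^ n) ((1 + x) ^ a) := by
  have h := (Real.one_add_rpow_hasFPowerSeriesOnBall_zero (a := a)).hasSum (y := x) (by
    simpa [Metric.mem_eball, edist_dist, Real.dist_eq] using hx)
  simpa [binomialSeries, List.ofFn_const, mul_comm] using h

theorem choose_real_succ (a : ℝ) (n : ℕ) :
    Ring.choose a (n + 1) = Ring.choose a n * (a - n) / (n + 1) := by
  have h := Ring.choose_smul_choose a (n := n+1) (k := n) (by simp)
  simp at h
  rw [eq_div_iff (by positivity), ← h]
  ring

theorem choose_real_succ_mul (a : ℝ) (n : ℕ) :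
    Ring.choose a (n + 1) = a / (n + 1) * Ring.choose (a - 1) n := by
  have h := Ring.choose_smul_choose a (n := n+1) (k := 1) (by simp)
  simp at h
  rw [div_mul_eq_mul_div, eq_div_iff (by positivity), ← h]
  ring

theorem hasSum_odd_part {c : ℕ → ℝ} {x u v : ℝ} (h₁ : HasSum (fun n => c n * x ^ n) u)
    (h₂ : HasSum (fun n => c n * (-x) ^ n) v) :
    HasSum (fun n => c (2 * n + 1) * x ^ (2 * n + 1)) ((u - v) / 2) := by
  have h := (h₁.sub h₂).div_const 2
  have hinj : Function.Injective fun n : ℕ => 2 * n + 1 := fun a b hab => by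
    simpa using hab
  refine ((hinj.hasSum_iff ?_).2 h).congr_fun ?_
  · intro m hm
    obtain ⟨k, hk | hk⟩ := Nat.even_or_odd' m
    · simp [hk, Even.neg_pow]
    · exact absurd ⟨k, hk.symm⟩ hm
  · intro n
    simp [(show Odd (2 * n + 1) from ⟨n, rfl⟩).neg_pow]

theorem hasSum_even_part {c : ℕ → ℝ} {x u v : ℝ} (h₁ : HasSum (fun n => c n * x ^ n) u)
    (h₂ : HasSum (fun n => c n * (-x) ^ n) v) :
    HasSum (fun n => c (2 * n) * x ^ (2 * n)) ((u + v) / 2) := by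
  have h := (h₁.add h₂).div_const 2
  have hinj : Function.Injective fun n : ℕ => 2 * n := fun a b hab => by
    simpa using hab
  refine ((hinj.hasSum_iff ?_).2 h).congr_fun ?_
  · intro m hm
    obtain ⟨k, hk | hk⟩ := Nat.even_or_odd' m
    · exact absurd ⟨k, hk.symm⟩ hm
    · simp [hk, (show Odd (2 * k + 1) from ⟨k, rfl⟩).neg_pow]
  · intro n
    simp [Even.neg_pow]

/-- The coefficients of `((1 - s) ^ (-δ) - (1 + s) ^ (-δ)) / (2 * δ * s)` as a power series in
`s ^ 2`. -/
def oddCoeff (δ : ℝ) : ℕ → ℝ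
  | 0 => 1
  | n + 1 => oddCoeff δ n * ((2 * n + 1 + δ) * (2 * n + 2 + δ) / ((2 * n + 2) * (2 * n + 3)))

theorem oddCoeff_pos {δ : ℝ} (hδ : 0 < δ) (n : ℕ) : 0 < oddCoeff δ n := by
  induction n with
  | zero => simp [oddCoeff]
  | succ n ih => rw [oddCoeff]; positivity

theorem choose_neg_odd (δ : ℝ) (n : ℕ) :
    Ring.choose (-δ) (2 * n + 1) = -(δ * oddCoeff δ n) := by
  induction n with
  | zero => simp [oddCoeff]
  | succ n ih =>
    rw [show 2 * (n + 1) + 1 = 2 * n + 1 + 1 + 1 by ring, choose_real_succ, choose_real_succ, ih,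
      oddCoeff]
    push_cast
    field_simp
    ring

theorem hasSum_oddCoeff {δ s : ℝ} (hδ : 0 < δ) (hs : |s| < 1) :
    HasSum (fun n => oddCoeff δ n * s ^ (2 * n + 1))
      (((1 - s) ^ (-δ) - (1 + s) ^ (-δ)) / (2 * δ)) := by
  have h := (hasSum_odd_part (hasSum_one_add_rpow (-δ) hs)
    (hasSum_one_add_rpow (-δ) (x := -s) (by simpa using hs))).div_const (-δ)
  have e : ((1 - s) ^ (-δ) - (1 + s) ^ (-δ)) / (2 * δ)
      = ((1 + s) ^ (-δ) - (1 + -s) ^ (-δ)) / 2 / -δ := by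
    rw [← sub_eq_add_neg]
    field_simp
    ring
  rw [e]
  refine h.congr_fun fun n => ?_
  rw [choose_neg_odd]
  field_simp

theorem hasSum_oddCoeff_deriv {δ s : ℝ} (hδ : 0 < δ) (hs : |s| < 1) :
    HasSum (fun n : ℕ => (2 * n + 1) * oddCoeff δ n * s ^ (2 * n))
      (((1 - s) ^ (-δ - 1) + (1 + s) ^ (-δ - 1)) / 2) := by
  have h := hasSum_even_part (hasSum_one_add_rpow (-δ - 1) hs)
    (hasSum_one_add_rpow (-δ - 1) (x := -s) (by simpa using hs))
  rw [← sub_eq_add_neg, add_comm] at h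
  refine h.congr_fun fun n => ?_
  have h1 := choose_neg_odd δ n
  rw [choose_real_succ_mul] at h1
  push_cast at h1
  field_simp at h1
  rw [neg_inj] at h1
  rw [← h1]

theorem hasSum_oddCoeff_integral {δ s : ℝ} (hδ : 0 < δ) (hδ' : δ < 1) (hs : |s| < 1) :
    HasSum (fun n : ℕ => oddCoeff δ n / (n + 1) * s ^ (2 * n + 2))
      ((2 - ((1 + s) ^ (1 - δ) + (1 - s) ^ (1 - δ))) / ((1 - δ) * δ)) := by
  have h := hasSum_even_part (hasSum_one_add_rpow (1 - δ) hs)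
    (hasSum_one_add_rpow (1 - δ) (x := -s) (by simpa using hs))
  rw [← hasSum_nat_add_iff' 1] at h
  have h0 : 1 - δ ≠ 0 := by linarith
  have e : (2 - ((1 + s) ^ (1 - δ) + (1 - s) ^ (1 - δ))) / ((1 - δ) * δ)
      = (((1 + s) ^ (1 - δ) + (1 + -s) ^ (1 - δ)) / 2 -
        ∑ i ∈ Finset.range 1, Ring.choose (1 - δ) (2 * i) * s ^ (2 * i)) *
          (-2 / ((1 - δ) * δ)) := by
    simp [← sub_eq_add_neg]
    field_simp
    ring
  rw [e]
  refine (h.mul_right (-2 / ((1 - δ) * δ))).congr_fun fun n => ?_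
  rw [show 2 * (n + 1) = 2 * n + 1 + 1 by ring, choose_real_succ_mul,
    show 1 - δ - 1 = -δ by ring, choose_neg_odd]
  push_cast
  field_simp
  ring

theorem oddCoeff_hasSum_deriv_le {δ v P Q : ℝ} (hδ : 0 < δ) (hδ' : δ < 1) (hv : 0 ≤ v)
    (hP : HasSum (fun n => oddCoeff δ n * v ^ n) P)
    (hQ : HasSum (fun n : ℕ => (2 * n + 1) * oddCoeff δ n * v ^ n) Q) :
    (1 - v) * Q ≤ P * (1 - v + 2 * v *
      ((1 + δ) * (2 + δ) / 6 - (1 - δ ^ 2) * (4 - δ ^ 2) / 90 * v)) := by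
  have hP1 := (hasSum_nat_add_iff' 1).2 hP
  have hP2 := (hasSum_nat_add_iff' 2).2 hP
  have hQ1 := (hasSum_nat_add_iff' 1).2 hQ
  have hQ2 := (hasSum_nat_add_iff' 2).2 hQ
  simp [Finset.sum_range_succ, oddCoeff] at hP1 hP2 hQ1 hQ2
  have h := ((((hQ2.sub (hQ1.mul_left v)).sub hP2).add (hP1.mul_left v)).sub
    (hP1.mul_left (v * ((1 + δ) * (2 + δ) / 3)))).add
    (hP.mul_left (v ^ 2 * ((1 - δ ^ 2) * (4 - δ ^ 2) / 45)))
  have h0 := hasSum_le (fun n => ?_) h hasSum_zero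
  · linear_combination h0
  · have hp := oddCoeff_pos hδ n
    have hv2 : 0 ≤ v ^ (n + 2) := by positivity
    have key : (2 * n + 4) * (((2 * n + 1 + δ) * (2 * n + 2 + δ) / ((2 * n + 2) * (2 * n + 3))) *
        ((2 * (n + 1) + 1 + δ) * (2 * (n + 1) + 2 + δ) / ((2 * (n + 1) + 2) * (2 * (n + 1) + 3)))) -
        (2 * n + 2 + (1 + δ) * (2 + δ) / 3) *
          ((2 * n + 1 + δ) * (2 * n + 2 + δ) / ((2 * n + 2) * (2 * n + 3))) +
        (1 - δ ^ 2) * (4 - δ ^ 2) / 45 =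
        -((1 - δ) * (2 - δ) / (45 * ((2 * n + 3) * (2 * n + 5))) *
          ((60 - 4 * (1 + δ) * (2 + δ)) * n ^ 2 + (58 + 12 * δ - 16 * δ ^ 2) * n)) := by
      field_simp
      ring
    have h1 : 0 ≤ 60 - 4 * (1 + δ) * (2 + δ) := by nlinarith
    have h2 : 0 ≤ 58 + 12 * δ - 16 * δ ^ 2 := by nlinarith
    have h3 : 0 ≤ (1 - δ) * (2 - δ) := mul_nonneg (by linarith) (by linarith)
    have h4 : 0 ≤ (1 - δ) * (2 - δ) / (45 * ((2 * n + 3) * (2 * n + 5))) *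
          ((60 - 4 * (1 + δ) * (2 + δ)) * n ^ 2 + (58 + 12 * δ - 16 * δ ^ 2) * n) := by positivity
    have h5 := mul_nonneg (mul_nonneg hp.le hv2) h4
    linear_combination h5 + oddCoeff δ n * v ^ (n + 2) * key

theorem one_lt_rpow_add_rpow {ω s : ℝ} (hω : ω < 1) (hs : 0 ≤ s) (hs' : s < 1) :
    1 < ((1 + s) / 2) ^ ω + ((1 - s) / 2) ^ ω := by
  have h1 := Real.rpow_lt_rpow_of_exponent_gt (x := (1 - s) / 2) (by linarith) (by linarith) hω
  have h2 := Real.rpow_le_rpow_of_exponent_ge (x := (1 + s) / 2) (by linarith) (by linarith) hω.le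
  rw [Real.rpow_one] at h1 h2
  linarith

theorem two_rpow_lt_add {ω s : ℝ} (hω : ω < 1) (hs : 0 ≤ s) (hs' : s < 1) :
    (2 : ℝ) ^ ω < (1 + s) ^ ω + (1 - s) ^ ω := by
  have h := one_lt_rpow_add_rpow hω hs hs'
  rw [Real.div_rpow (by linarith) (by norm_num), Real.div_rpow (by linarith) (by norm_num),
    ← add_div, one_lt_div (by positivity)] at h
  exact h

/-- `(2 - 2 ^ (1 - δ)) / ((1 - δ) * δ)` bounds the partial sums of `∑ oddCoeff δ n / (n + 1)`. -/
theorem sum_oddCoeff_div_le {δ : ℝ} (hδ : 0 < δ) (hδ' : δ < 1) (n : ℕ) :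
    ∑ j ∈ Finset.range n, oddCoeff δ j / (j + 1) ≤ (2 - 2 ^ (1 - δ)) / ((1 - δ) * δ) := by
  have hc : Tendsto (fun s : ℝ => ∑ j ∈ Finset.range n, oddCoeff δ j / (j + 1) * s ^ (2 * j + 2))
      (𝓝[<] 1) (𝓝 (∑ j ∈ Finset.range n, oddCoeff δ j / (j + 1) * 1 ^ (2 * j + 2))) := by
    refine Tendsto.mono_left (Continuous.tendsto ?_ 1) nhdsWithin_le_nhds
    fun_prop
  simp only [one_pow, mul_one] at hc
  refine le_of_tendsto hc ?_
  filter_upwards [Ioo_mem_nhdsLT (show (0 : ℝ) < 1 by norm_num)] with s hs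
  have hd : 0 < (1 - δ) * δ := mul_pos (by linarith) hδ
  have hS := hasSum_oddCoeff_integral hδ hδ' (s := s) (by rw [abs_of_pos hs.1]; exact hs.2)
  refine (sum_le_hasSum _ (fun j _ => ?_) hS).trans ?_
  · have := oddCoeff_pos hδ j
    have := hs.1
    positivity
  · have := two_rpow_lt_add (ω := 1 - δ) (by linarith) hs.1.le hs.2
    gcongr

theorem oddCoeff_antitone {δ : ℝ} (hδ : 0 < δ) (hδ' : δ < 1) : Antitone (oddCoeff δ) := by
  refine antitone_nat_of_succ_le fun n => ?_
  rw [oddCoeff]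
  refine mul_le_of_le_one_right (oddCoeff_pos hδ n).le ?_
  rw [div_le_one (by positivity)]
  nlinarith

theorem tendsto_oddCoeff {δ : ℝ} (hδ : 0 < δ) (hδ' : δ < 1) :
    Tendsto (oddCoeff δ) atTop (𝓝 0) := by
  set c := (2 - 2 ^ (1 - δ)) / ((1 - δ) * δ)
  have hlim := Real.tendsto_sum_range_one_div_nat_succ_atTop
  refine squeeze_zero' (Eventually.of_forall fun n => (oddCoeff_pos hδ n).le) ?_
    (hlim.const_div_atTop c)
  filter_upwards [eventually_gt_atTop 0] with n hn
  rw [le_div_iff₀ (Finset.sum_pos (fun i _ => by positivity) (by simpa using hn.ne')),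
    Finset.mul_sum]
  refine le_trans (Finset.sum_le_sum fun j hj => ?_) (sum_oddCoeff_div_le hδ hδ' n)
  rw [mul_one_div]
  gcongr
  exact oddCoeff_antitone hδ hδ' (Finset.mem_range.1 hj).le

/-- A lower bound for the tails of `∑ oddCoeff δ n / (n + 1)`. -/
theorem oddCoeff_div_le_tail {δ : ℝ} (hδ : 0 < δ) (hδ' : δ < 1) (n : ℕ) :
    oddCoeff δ n / (1 - δ) ≤ (2 - 2 ^ (1 - δ)) / ((1 - δ) * δ) -
      ∑ j ∈ Finset.range n, oddCoeff δ j / (j + 1) := by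
  set c := (2 - 2 ^ (1 - δ)) / ((1 - δ) * δ)
  have h1 : 0 < 1 - δ := by linarith
  have hanti : Antitone fun n => c - ∑ j ∈ Finset.range n, oddCoeff δ j / (j + 1) -
      oddCoeff δ n / (1 - δ) := by
    refine antitone_nat_of_succ_le fun n => ?_
    have hp := oddCoeff_pos hδ n
    rw [Finset.sum_range_succ]
    have key : 1 / (1 - δ) * (1 - (2 * n + 1 + δ) * (2 * n + 2 + δ) /
        ((2 * n + 2) * (2 * n + 3))) ≤ 1 / ((n : ℝ) + 1) := by
      rw [one_div_mul_eq_div, div_le_div_iff₀ h1 (by positivity)]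
      have e : (1 - (2 * n + 1 + δ) * (2 * n + 2 + δ) / ((2 * n + 2) * (2 * n + 3))) * ((n : ℝ) + 1)
          = (4 * n + 4 - δ * (4 * n + 3) - δ ^ 2) / (2 * (2 * n + 3)) := by
        field_simp
        ring
      rw [e, div_le_iff₀ (by positivity)]
      nlinarith
    have := mul_le_mul_of_nonneg_left key hp.le
    rw [oddCoeff]
    have e : oddCoeff δ n / (1 - δ) - oddCoeff δ n * ((2 * n + 1 + δ) * (2 * n + 2 + δ) /
        ((2 * n + 2) * (2 * n + 3))) / (1 - δ) = oddCoeff δ n * (1 / (1 - δ) *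
        (1 - (2 * n + 1 + δ) * (2 * n + 2 + δ) / ((2 * n + 2) * (2 * n + 3)))) := by ring
    have e' : oddCoeff δ n * (1 / ((n : ℝ) + 1)) = oddCoeff δ n / (n + 1) := by ring
    linarith
  have hlim : Tendsto (fun n => -(oddCoeff δ n / (1 - δ))) atTop (𝓝 0) := by
    simpa using ((tendsto_oddCoeff hδ hδ').div_const (1 - δ)).neg
  have : 0 ≤ c - ∑ j ∈ Finset.range n, oddCoeff δ j / (j + 1) - oddCoeff δ n / (1 - δ) := by
    refine le_of_tendsto hlim ?_
    filter_upwards [eventually_ge_atTop n] with m hm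
    have h2 := hanti hm
    have h3 := sum_oddCoeff_div_le hδ hδ' m
    simp only at h2
    linarith
  linarith

theorem oddCoeff_hasSum_le_integral {δ v P S c : ℝ} (hδ : 0 < δ) (hδ' : δ < 1)
    (hc : c = (2 - 2 ^ (1 - δ)) / ((1 - δ) * δ)) (hv : 0 ≤ v) (hv' : v < 1)
    (hP : HasSum (fun n => oddCoeff δ n * v ^ n) P)
    (hS : HasSum (fun n : ℕ => oddCoeff δ n / (n + 1) * v ^ (n + 1)) S) :
    (1 - v) * P ≤ (1 / c + (1 - δ - 1 / c) * v) * (c - S) := by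
  have h1 : 0 < 1 - δ := by linarith
  set t : ℕ → ℝ := fun n => c - ∑ j ∈ Finset.range n, oddCoeff δ j / (j + 1) with ht
  have htail : ∀ n, oddCoeff δ n / (1 - δ) ≤ t n := fun n => by
    simpa [ht, hc] using oddCoeff_div_le_tail hδ hδ' n
  have ht0 : t 0 = c := by simp [ht]
  have hts : ∀ n, t n - t (n + 1) = oddCoeff δ n / (n + 1) := fun n => by
    simp [ht, Finset.sum_range_succ]
  have htanti : Antitone t := antitone_nat_of_succ_le fun n => by
    have := hts n
    have : 0 ≤ oddCoeff δ n / (n + 1) := div_nonneg (oddCoeff_pos hδ n).le (by positivity)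
    linarith
  have htpos : ∀ n, 0 ≤ t n := fun n =>
    (div_nonneg (oddCoeff_pos hδ n).le h1.le).trans (htail n)
  have hc1 : 1 / (1 - δ) ≤ c := by simpa [ht0, oddCoeff] using htail 0
  have hcpos : 0 < c := lt_of_lt_of_le (by positivity) hc1
  have hcle : 1 / c ≤ 1 - δ := by
    rw [div_le_iff₀ hcpos]
    rwa [div_le_iff₀ h1, mul_comm] at hc1
  obtain ⟨T, hT⟩ : Summable fun n => t n * v ^ n :=
    Summable.of_nonneg_of_le (fun n => mul_nonneg (htpos n) (by positivity))
      (fun n => mul_le_mul_of_nonneg_right (htanti (Nat.zero_le n)) (by positivity))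
      ((summable_geometric_of_lt_one hv hv').mul_left (t 0))
  have hT1 := (hasSum_nat_add_iff' 1).2 hT
  have hP1 := (hasSum_nat_add_iff' 1).2 hP
  simp only [Finset.sum_range_succ, Finset.sum_range_zero, pow_zero, mul_one, zero_add, ht0] at hT1
  simp only [Finset.sum_range_succ, Finset.sum_range_zero, pow_zero, mul_one, zero_add] at hP1
  rw [show oddCoeff δ 0 = 1 from rfl] at hP1
  have hTS : c - S = (1 - v) * T := by
    have := ((hT.mul_left v).sub hT1).unique (hS.congr_fun fun n => by rw [← hts]; ring)
    linarith
  have hPT : P ≤ (1 / c + (1 - δ - 1 / c) * v) * T := by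
    have h := hasSum_le (fun n => ?_) hP1
      ((hT1.mul_left (1 / c)).add (hT.mul_left ((1 - δ - 1 / c) * v)))
    · have : 1 / c * c = 1 := by field_simp
      linarith
    · have h2 := htail (n + 1)
      rw [div_le_iff₀ h1] at h2
      have h3 := htanti (Nat.le_succ n)
      have h4 : 0 ≤ v ^ (n + 1) := by positivity
      have h5 := mul_le_mul_of_nonneg_left h3 (sub_nonneg.2 hcle)
      have h6 : oddCoeff δ (n + 1) ≤ 1 / c * t (n + 1) + (1 - δ - 1 / c) * t n := by
        simp only [Nat.succ_eq_add_one] at h5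
        linarith
      have h7 := mul_le_mul_of_nonneg_right h6 h4
      linear_combination h7
  rw [hTS]
  have := mul_le_mul_of_nonneg_left hPT (sub_nonneg.2 hv'.le)
  linarith

theorem one_sub_two_rpow_neg_lower {δ : ℝ} (hδ : 0 < δ) (hδ' : δ ≤ 0.14202) :
    3 * δ ^ 2 * (1 - δ) ≤ (1 - 3 * δ - δ ^ 2) * (1 - 2 ^ (-δ)) := by
  set x := 0.6931471803 * δ with hx
  have hx0 : 0 ≤ x := by positivity
  have hx1 : x ≤ 1 := by rw [hx]; linarith
  have h2 : (2 : ℝ) ^ (-δ) ≤ Real.exp (-x) := by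
    rw [Real.rpow_def_of_pos (by norm_num)]
    refine Real.exp_le_exp.2 ?_
    have := Real.log_two_gt_d9
    rw [hx]
    nlinarith
  have h3 := (abs_le.1 (Real.exp_bound (x := -x) (by rwa [abs_neg, abs_of_nonneg hx0])
    (show 0 < 5 by norm_num))).2
  rw [abs_neg, abs_of_nonneg hx0] at h3
  norm_num [Finset.sum_range_succ, Nat.factorial] at h3
  have h4 : x - x ^ 2 / 2 + x ^ 3 / 6 - x ^ 4 / 24 - x ^ 5 / 100 ≤ 1 - 2 ^ (-δ) := by
    linarith
  refine le_trans ?_ (mul_le_mul_of_nonneg_left h4 (by nlinarith))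
  rw [hx]
  obtain ⟨e, rfl⟩ : ∃ e, δ = 0.14202 - e := ⟨0.14202 - δ, by ring⟩
  have he : 0 ≤ e := by linarith
  have he' : e ≤ 0.14202 := by linarith
  rw [← sub_nonneg]
  have key : 0 ≤ (1 - 3 * (0.14202 - e) - (0.14202 - e) ^ 2) * (0.6931471803 *
      (1 - (0.6931471803 * (0.14202 - e)) / 2 + (0.6931471803 * (0.14202 - e)) ^ 2 / 6 -
      (0.6931471803 * (0.14202 - e)) ^ 3 / 24 - (0.6931471803 * (0.14202 - e)) ^ 4 / 100)) -
      3 * (0.14202 - e) * (1 - (0.14202 - e)) := by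
    have e2 : e ^ 3 ≤ 0.14202 * e ^ 2 := by nlinarith [sq_nonneg e]
    have e3 : e ^ 4 ≤ 0.14202 * e ^ 3 := by nlinarith [pow_nonneg he 3]
    have e4 : e ^ 5 ≤ 0.14202 * e ^ 4 := by nlinarith [pow_nonneg he 4]
    have e5 : e ^ 6 ≤ 0.14202 * e ^ 5 := by nlinarith [pow_nonneg he 5]
    nlinarith [pow_nonneg he 2, pow_nonneg he 3, pow_nonneg he 4, pow_nonneg he 5,
      pow_nonneg he 6]
  have := mul_nonneg hδ.le key
  linear_combination this

/-- The base of `hFun (1 - δ)` as a function of `s = √(1 - θ ^ 2)`. -/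
def qFun (δ s : ℝ) : ℝ := ((1 + s) / 2) ^ (1 - δ) + ((1 - s) / 2) ^ (1 - δ) - 1

/-- The negative of the derivative of `qFun δ`. -/
def qDeriv (δ s : ℝ) : ℝ := (1 - δ) / 2 * (((1 - s) / 2) ^ (-δ) - ((1 + s) / 2) ^ (-δ))

/-- The derivative of `qDeriv δ`. -/
def qDeriv' (δ s : ℝ) : ℝ :=
  (1 - δ) / 2 * (δ / 2) * (((1 - s) / 2) ^ (-δ - 1) + ((1 + s) / 2) ^ (-δ - 1))

theorem qFun_deriv_inequality {δ s : ℝ} (hδ : 0 < δ) (hδ' : δ ≤ 0.14202) (hs : 0 < s)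
    (hs' : s < 1) :
    (δ * qDeriv δ s ^ 2 + qDeriv' δ s * qFun δ s) * (s * (1 - s ^ 2)) ≤
      qFun δ s * qDeriv δ s := by
  have hδ1 : δ < 1 := by linarith
  have hsa : |s| < 1 := by rwa [abs_of_pos hs]
  set v := s ^ 2 with hv
  have hv0 : 0 < v := by positivity
  have hv1 : v < 1 := by nlinarith
  set c := (2 - 2 ^ (1 - δ)) / ((1 - δ) * δ) with hc
  set P := ((1 - s) ^ (-δ) - (1 + s) ^ (-δ)) / (2 * δ) / s with hPdef
  set Q := ((1 - s) ^ (-δ - 1) + (1 + s) ^ (-δ - 1)) / 2 with hQdef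
  set S := (2 - ((1 + s) ^ (1 - δ) + (1 - s) ^ (1 - δ))) / ((1 - δ) * δ) with hSdef
  have hP : HasSum (fun n => oddCoeff δ n * v ^ n) P := by
    refine ((hasSum_oddCoeff hδ hsa).div_const s).congr_fun fun n => ?_
    rw [hv, ← pow_mul, pow_succ]
    field_simp
  have hQ : HasSum (fun n : ℕ => (2 * n + 1) * oddCoeff δ n * v ^ n) Q := by
    refine (hasSum_oddCoeff_deriv hδ hsa).congr_fun fun n => ?_
    rw [hv, ← pow_mul]
  have hS : HasSum (fun n : ℕ => oddCoeff δ n / (n + 1) * v ^ (n + 1)) S := by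
    refine (hasSum_oddCoeff_integral hδ hδ1 hsa).congr_fun fun n => ?_
    rw [hv, ← pow_mul, mul_add, mul_one]
  have hA := oddCoeff_hasSum_deriv_le hδ hδ1 hv0.le hP hQ
  have hB := oddCoeff_hasSum_le_integral hδ hδ1 hc hv0.le hv1 hP hS
  have hPpos : 0 < P := lt_of_lt_of_le one_pos (by
    simpa [oddCoeff] using le_hasSum hP 0 fun j _ =>
      mul_nonneg (oddCoeff_pos hδ j).le (pow_nonneg hv0.le j))
  have h1δ : 0 < 1 - δ := by linarith
  have hIpos : 0 < c - S := by
    have h := two_rpow_lt_add (ω := 1 - δ) (by linarith) hs.le hs'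
    rw [hc, hSdef, ← sub_div]
    exact div_pos (by linarith) (by positivity)
  have e1 : (2 : ℝ) ^ (1 - δ) = 2 * 2 ^ (-δ) := by
    rw [sub_eq_add_neg, Real.rpow_add (by norm_num), Real.rpow_one]
  have hkey : 2 * δ * (1 / c) + (1 + δ) * (2 + δ) / 3 ≤ 1 := by
    have hn := one_sub_two_rpow_neg_lower hδ hδ'
    have hlt : (2 : ℝ) ^ (-δ) < 1 := Real.rpow_lt_one_of_one_lt_of_neg (by norm_num) (by linarith)
    have h2 : 0 < 1 - (2 : ℝ) ^ (-δ) := by linarith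
    have e : 2 * δ * (1 / c) = δ ^ 2 * (1 - δ) / (1 - 2 ^ (-δ)) := by
      rw [hc, e1]
      have : (2 : ℝ) - 2 * 2 ^ (-δ) ≠ 0 := by linarith
      field_simp
    have : δ ^ 2 * (1 - δ) / (1 - 2 ^ (-δ)) ≤ (1 - 3 * δ - δ ^ 2) / 3 := by
      rw [div_le_iff₀ h2]
      linarith
    rw [e]
    linarith
  have hlin : 2 * δ * (1 / c + (1 - δ - 1 / c) * v) +
      2 * ((1 + δ) * (2 + δ) / 6 - (1 - δ ^ 2) * (4 - δ ^ 2) / 90 * v) ≤ 1 := by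
    have hend : 2 * δ * (1 - δ) + (1 + δ) * (2 + δ) / 3 - (1 - δ ^ 2) * (4 - δ ^ 2) / 45 ≤ 1 := by
      nlinarith [mul_nonneg hδ.le hδ.le, mul_nonneg (sub_nonneg.2 hδ') hδ.le,
        mul_nonneg (mul_nonneg hδ.le hδ.le) (sub_nonneg.2 hδ'), pow_nonneg hδ.le 4]
    have h1 := mul_le_mul_of_nonneg_left hkey (sub_nonneg.2 hv1.le)
    have h2 := mul_le_mul_of_nonneg_left hend hv0.le
    linear_combination h1 + h2
  have hmain : 2 * δ * v * ((1 - v) * P) * P + (1 - v) * Q * (c - S) ≤ P * (c - S) := by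
    have h1 := mul_le_mul_of_nonneg_left hB (show 0 ≤ 2 * δ * v * P by positivity)
    have h2 := mul_le_mul_of_nonneg_right hA hIpos.le
    have h3 := mul_le_mul_of_nonneg_left hlin (show 0 ≤ v * P * (c - S) by positivity)
    linear_combination h1 + h2 + h3
  have hp2 : (0 : ℝ) < 2 ^ (-δ) := by positivity
  have eN : qDeriv δ s = (1 - δ) * δ / 2 ^ (-δ) * (s * P) := by
    rw [qDeriv, hPdef, Real.div_rpow (by linarith) (by norm_num),
      Real.div_rpow (by linarith) (by norm_num)]
    field_simp
  have e3 : (2 : ℝ) ^ (-δ - 1) = 2 ^ (-δ) / 2 := by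
    rw [Real.rpow_sub (by norm_num), Real.rpow_one]
  have eN' : qDeriv' δ s = (1 - δ) * δ / 2 ^ (-δ) * Q := by
    rw [qDeriv', hQdef, Real.div_rpow (by linarith) (by norm_num),
      Real.div_rpow (by linarith) (by norm_num), e3]
    field_simp
  have eF : qFun δ s = (1 - δ) * δ / 2 ^ (-δ) * ((c - S) / 2) := by
    rw [qFun, hc, hSdef, Real.div_rpow (by linarith) (by norm_num),
      Real.div_rpow (by linarith) (by norm_num), e1]
    field_simp
    ring
  rw [eN, eN', eF]
  have h := mul_le_mul_of_nonneg_left hmain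
    (show 0 ≤ ((1 - δ) * δ / 2 ^ (-δ)) ^ 2 * (s / 2) by positivity)
  rw [hv] at h
  linear_combination h

theorem qFun_pos {δ s : ℝ} (hδ : 0 < δ) (hs : 0 ≤ s) (hs' : s < 1) : 0 < qFun δ s := by
  have := one_lt_rpow_add_rpow (ω := 1 - δ) (by linarith) hs hs'
  rw [qFun]
  linarith

theorem qDeriv_nonneg {δ s : ℝ} (hδ : 0 < δ) (hδ' : δ < 1) (hs : 0 ≤ s) (hs' : s < 1) :
    0 ≤ qDeriv δ s := by
  rw [qDeriv]
  refine mul_nonneg (by linarith) (sub_nonneg.2 ?_)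
  exact Real.rpow_le_rpow_of_nonpos (by linarith) (by linarith) (by linarith)

theorem hasDerivAt_qFun {δ s : ℝ} (hs : -1 < s) (hs' : s < 1) :
    HasDerivAt (qFun δ) (-qDeriv δ s) s := by
  have h1 : HasDerivAt (fun s : ℝ => (1 + s) / 2) (1 / 2) s :=
    ((hasDerivAt_id s).const_add 1).div_const 2
  have h2 : HasDerivAt (fun s : ℝ => (1 - s) / 2) (-1 / 2) s :=
    ((hasDerivAt_id s).const_sub 1).div_const 2
  have h := ((h1.rpow_const (p := 1 - δ) (Or.inl (by linarith))).add
    (h2.rpow_const (p := 1 - δ) (Or.inl (by linarith)))).sub_const 1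
  refine h.congr_deriv ?_
  rw [qDeriv, show 1 - δ - 1 = -δ by ring]
  ring

theorem hasDerivAt_qDeriv {δ s : ℝ} (hs : -1 < s) (hs' : s < 1) :
    HasDerivAt (qDeriv δ) (qDeriv' δ s) s := by
  have h1 : HasDerivAt (fun s : ℝ => (1 + s) / 2) (1 / 2) s :=
    ((hasDerivAt_id s).const_add 1).div_const 2
  have h2 : HasDerivAt (fun s : ℝ => (1 - s) / 2) (-1 / 2) s :=
    ((hasDerivAt_id s).const_sub 1).div_const 2
  have h := ((h2.rpow_const (p := -δ) (Or.inl (by linarith))).sub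
    (h1.rpow_const (p := -δ) (Or.inl (by linarith)))).const_mul ((1 - δ) / 2)
  refine h.congr_deriv ?_
  rw [qDeriv']
  ring

/-- The derivative of `hFun (1 - δ)` at `√(1 - s ^ 2)`, up to the factor `1 - δ`. -/
def hSlope (δ s : ℝ) : ℝ := qFun δ s ^ (-δ) * qDeriv δ s * (Real.sqrt (1 - s ^ 2) / s)

theorem antitoneOn_hSlope {δ : ℝ} (hδ : 0 < δ) (hδ' : δ ≤ 0.14202) :
    AntitoneOn (hSlope δ) (Set.Ioo 0 1) := by
  have hd : ∀ s ∈ Set.Ioo (0 : ℝ) 1, HasDerivAt (hSlope δ)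
      (qFun δ s ^ (-δ - 1) * (Real.sqrt (1 - s ^ 2) / s) / (s * (1 - s ^ 2)) *
        ((δ * qDeriv δ s ^ 2 + qDeriv' δ s * qFun δ s) * (s * (1 - s ^ 2)) -
          qFun δ s * qDeriv δ s)) s := by
    intro s hs
    have hF := qFun_pos hδ hs.1.le hs.2
    have hs2 : 0 < 1 - s ^ 2 := by nlinarith [hs.1, hs.2]
    have hsq : HasDerivAt (fun s : ℝ => 1 - s ^ 2) (-(2 * s)) s := by
      simpa using (hasDerivAt_pow 2 s).const_sub 1
    have h := (((hasDerivAt_qFun (δ := δ) (by linarith [hs.1]) hs.2).rpow_const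
      (p := -δ) (Or.inl hF.ne')).mul (hasDerivAt_qDeriv (δ := δ) (by linarith [hs.1]) hs.2)).mul
      ((hsq.sqrt hs2.ne').div (hasDerivAt_id s) hs.1.ne')
    refine h.congr_deriv ?_
    have e : qFun δ s ^ (-δ) = qFun δ s ^ (-δ - 1) * qFun δ s := by
      rw [← Real.rpow_add_one hF.ne', sub_add_cancel]
    have hr := Real.sqrt_pos.2 hs2
    have hr2 := Real.sq_sqrt hs2.le
    have hs0 := hs.1
    simp only [id, Pi.mul_apply, Pi.div_apply]
    rw [e]
    generalize Real.sqrt (1 - s ^ 2) = r at *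
    rw [← hr2]
    field_simp
    linear_combination -(qDeriv δ s * qFun δ s) * hr2
  refine antitoneOn_of_deriv_nonpos (convex_Ioo 0 1)
    (fun s hs => (hd s hs).continuousAt.continuousWithinAt)
    (fun s hs => (hd s (interior_subset hs)).differentiableAt.differentiableWithinAt) ?_
  intro s hs
  rw [interior_Ioo] at hs
  rw [(hd s hs).deriv]
  have hF := qFun_pos hδ hs.1.le hs.2
  have hs2 : 0 < 1 - s ^ 2 := by nlinarith [hs.1, hs.2]
  have hs0 := hs.1
  refine mul_nonpos_of_nonneg_of_nonpos (by positivity) ?_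
  have := qFun_deriv_inequality hδ hδ' hs.1 hs.2
  linarith

theorem continuous_hFun {δ : ℝ} (hδ : δ < 1) : Continuous (hFun (1 - δ)) := by
  have h : 0 ≤ 1 - δ := by linarith
  unfold hFun
  refine Continuous.rpow_const ?_ fun _ => Or.inr h
  refine (Continuous.add ?_ ?_).sub continuous_const
  · exact Continuous.rpow_const (by fun_prop) fun _ => Or.inr h
  · exact Continuous.rpow_const (by fun_prop) fun _ => Or.inr h

theorem sqrt_one_sub_sq_mem_Ioo {θ : ℝ} (hθ : θ ∈ Set.Ioo (0 : ℝ) 1) :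
    Real.sqrt (1 - θ ^ 2) ∈ Set.Ioo (0 : ℝ) 1 := by
  refine ⟨Real.sqrt_pos.2 (by nlinarith [hθ.1, hθ.2]), ?_⟩
  rw [Real.sqrt_lt' one_pos]
  nlinarith [hθ.1]

theorem hasDerivAt_hFun {δ θ : ℝ} (hδ : 0 < δ) (hθ : θ ∈ Set.Ioo (0 : ℝ) 1) :
    HasDerivAt (hFun (1 - δ)) ((1 - δ) * hSlope δ (Real.sqrt (1 - θ ^ 2))) θ := by
  have hθ2 : 0 < 1 - θ ^ 2 := by nlinarith [hθ.1, hθ.2]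
  have hs := Real.sqrt_pos.2 hθ2
  have hs1 := (sqrt_one_sub_sq_mem_Ioo hθ).2
  have hsq : HasDerivAt (fun s : ℝ => 1 - s ^ 2) (-(2 * θ)) θ := by
    simpa using (hasDerivAt_pow 2 θ).const_sub 1
  have hF := qFun_pos hδ hs.le hs1
  have h := ((hasDerivAt_qFun (δ := δ) (by linarith) hs1).comp θ
    (hsq.sqrt hθ2.ne')).rpow_const (p := 1 - δ) (Or.inl hF.ne')
  refine h.congr_deriv ?_
  simp only [Function.comp]
  rw [hSlope, Real.sq_sqrt hθ2.le, sub_sub_cancel, Real.sqrt_sq hθ.1.le,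
    show 1 - δ - 1 = -δ by ring]
  field_simp

theorem hFun_one (θ : ℝ) : hFun 1 θ = 0 := by
  simp only [hFun, Real.rpow_one]
  ring

theorem convexOn_hFun {ω : ℝ} (hω₀ : 0.85798 ≤ ω) (hω₁ : ω ≤ 1) :
    ConvexOn ℝ (Set.Icc 0 1) (hFun ω) := by
  obtain rfl | hω := hω₁.eq_or_lt
  · rw [show hFun 1 = fun _ => 0 from funext hFun_one]
    exact convexOn_const 0 (convex_Icc 0 1)
  obtain ⟨δ, rfl⟩ : ∃ δ, ω = 1 - δ := ⟨1 - ω, by ring⟩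
  have hδ : 0 < δ := by linarith
  have hδ' : δ ≤ 0.14202 := by linarith
  refine MonotoneOn.convexOn_of_deriv (convex_Icc 0 1)
    (continuous_hFun (by linarith)).continuousOn ?_ ?_
  · rw [interior_Icc]
    exact fun θ hθ => (hasDerivAt_hFun hδ hθ).differentiableAt.differentiableWithinAt
  · rw [interior_Icc]
    intro θ hθ θ' hθ' h
    rw [(hasDerivAt_hFun hδ hθ).deriv, (hasDerivAt_hFun hδ hθ').deriv]
    refine mul_le_mul_of_nonneg_left (antitoneOn_hSlope hδ hδ' (sqrt_one_sub_sq_mem_Ioo hθ')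
      (sqrt_one_sub_sq_mem_Ioo hθ) ?_) (by linarith)
    exact Real.sqrt_le_sqrt (by nlinarith [hθ.1])

theorem monotoneOn_hFun {ω : ℝ} (hω₀ : 0 < ω) (hω₁ : ω ≤ 1) :
    MonotoneOn (hFun ω) (Set.Icc 0 1) := by
  obtain rfl | hω := hω₁.eq_or_lt
  · rw [show hFun 1 = fun _ => 0 from funext hFun_one]
    exact monotoneOn_const
  obtain ⟨δ, rfl⟩ : ∃ δ, ω = 1 - δ := ⟨1 - ω, by ring⟩
  have hδ : 0 < δ := by linarith
  refine monotoneOn_of_deriv_nonneg (convex_Icc 0 1)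
    (continuous_hFun (by linarith)).continuousOn ?_ ?_
  · rw [interior_Icc]
    exact fun θ hθ => (hasDerivAt_hFun hδ hθ).differentiableAt.differentiableWithinAt
  · rw [interior_Icc]
    intro θ hθ
    rw [(hasDerivAt_hFun hδ hθ).deriv, hSlope]
    have hs := sqrt_one_sub_sq_mem_Ioo hθ
    have hF := qFun_pos hδ hs.1.le hs.2
    have hD := qDeriv_nonneg hδ (by linarith) hs.1.le hs.2
    have := hs.1
    have : 0 ≤ 1 - δ := by linarith
    positivity

/-- A symmetric conjugate-linear map has, on any nonzero invariant subspace, a unit eigenvector with a nonnegative eigenvalue. -/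
theorem exists_unit_eigenvector_of_conjLinear {E : Type*} [NormedAddCommGroup E]
    [InnerProductSpace ℂ E] [FiniteDimensional ℂ E] (T : E →ₛₗ[starRingEnd ℂ] E)
    (hT : ∀ x y, inner ℂ x (T y) = inner ℂ y (T x)) (V : Submodule ℂ E) (hV : V ≠ ⊥)
    (hTV : ∀ x ∈ V, T x ∈ V) :
    ∃ x ∈ V, ‖x‖ = 1 ∧ ∃ r : ℝ, 0 ≤ r ∧ T x = (r : ℂ) • x := by
  suffices h : ∃ x ∈ V, x ≠ 0 ∧ ∃ r : ℝ, 0 ≤ r ∧ T x = (r : ℂ) • x by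
    obtain ⟨x, hx, hx0, r, hr, hTx⟩ := h
    refine ⟨((‖x‖⁻¹ : ℝ) : ℂ) • x, V.smul_mem _ hx, ?_, r, hr, ?_⟩
    · rw [norm_smul]
      simp [hx0]
    · rw [map_smulₛₗ, hTx, Complex.conj_ofReal, smul_comm]
  have : Nontrivial V := Submodule.nontrivial_iff_ne_bot.2 hV
  obtain ⟨μ, hμ⟩ := Module.End.exists_eigenvalue
    (((T.comp T : E →ₗ[ℂ] E)).restrict (p := V) (q := V) fun x hx => hTV _ (hTV _ hx))
  obtain ⟨y', hy'⟩ := hμ.exists_hasEigenvector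
  obtain ⟨y, hyV⟩ := y'
  have hy0 : y ≠ 0 := fun h => hy'.2 (Subtype.ext h)
  have hy : T (T y) = μ • y := congrArg Subtype.val hy'.apply_eq_smul
  have hμr : μ = ((‖T y‖ / ‖y‖ : ℝ) : ℂ) ^ 2 := by
    have h := hT y (T y)
    rw [hy, inner_smul_right, inner_self_eq_norm_sq_to_K, inner_self_eq_norm_sq_to_K] at h
    have : (‖y‖ : ℂ) ≠ 0 := by simpa using hy0
    push_cast
    field_simp
    simpa using h
  set r : ℝ := ‖T y‖ / ‖y‖
  have hr : 0 ≤ r := by positivity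
  by_cases hz : T y + (r : ℂ) • y = 0
  · refine ⟨Complex.I • y, V.smul_mem _ hyV, by simpa using hy0, r, hr, ?_⟩
    rw [map_smulₛₗ, eq_neg_of_add_eq_zero_left hz, smul_neg, Complex.conj_I, neg_smul, neg_neg,
      smul_comm]
  · refine ⟨T y + (r : ℂ) • y, V.add_mem (hTV _ hyV) (V.smul_mem _ hyV), hz, r, hr, ?_⟩
    rw [map_add, map_smulₛₗ, hy, Complex.conj_ofReal, hμr, smul_add, smul_smul, ← sq, add_comm]

theorem exists_orthonormal_eigenvectors_of_conjLinear {E : Type*} [NormedAddCommGroup E]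
    [InnerProductSpace ℂ E] [FiniteDimensional ℂ E] (T : E →ₛₗ[starRingEnd ℂ] E)
    (hT : ∀ x y, inner ℂ x (T y) = inner ℂ y (T x)) (k : ℕ) (hk : k ≤ Module.finrank ℂ E) :
    ∃ (u : Fin k → E) (r : Fin k → ℝ), Orthonormal ℂ u ∧
      ∀ i, 0 ≤ r i ∧ T (u i) = (r i : ℂ) • u i := by
  induction k with
  | zero => exact ⟨Fin.elim0, Fin.elim0, by simp, fun i => i.elim0⟩
  | succ k ih =>
    obtain ⟨u, r, hu, hur⟩ := ih (by omega)
    obtain ⟨x, hx, hx1, s, hs, hTx⟩ := exists_unit_eigenvector_of_conjLinear T hT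
      (Submodule.span ℂ (Set.range u))ᗮ (by
        rw [Ne, Submodule.orthogonal_eq_bot_iff]
        intro h
        have h1 := finrank_span_eq_card hu.linearIndependent
        rw [h, finrank_top, Fintype.card_fin] at h1
        omega) (by
        intro x hx
        rw [Submodule.mem_orthogonal] at hx ⊢
        intro v hv
        induction hv using Submodule.span_induction with
        | mem v hv =>
          obtain ⟨i, rfl⟩ := hv
          rw [hT, (hur i).2, inner_smul_right, inner_eq_zero_symm.1
            (hx _ (Submodule.subset_span ⟨i, rfl⟩)), mul_zero]
        | zero => simp
        | add a b _ _ ha hb => rw [inner_add_left, ha, hb, add_zero]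
        | smul c a _ ha => rw [inner_smul_left, ha, mul_zero])
    refine ⟨Matrix.vecCons x u, Matrix.vecCons s r, orthonormal_vecCons_iff.2 ⟨hx1, ?_, hu⟩, ?_⟩
    · intro i
      exact inner_eq_zero_symm.1 ((Submodule.mem_orthogonal _ _).1 hx _
        (Submodule.subset_span ⟨i, rfl⟩))
    · intro i
      refine Fin.cases ?_ (fun i => ?_) i
      · exact ⟨hs, hTx⟩
      · exact hur i

/-- The conjugate-linear map `x ↦ conj (M x)`. -/
def conjMulVec {n : Type*} [Fintype n] (M : Matrix n n ℂ) :
    EuclideanSpace ℂ n →ₛₗ[starRingEnd ℂ] EuclideanSpace ℂ n where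
  toFun x := WithLp.toLp 2 (star (M *ᵥ x.ofLp))
  map_add' x y := by ext i; simp [Matrix.mulVec_add]
  map_smul' c x := by ext i; simp [Matrix.mulVec_smul]

theorem conjMulVec_symm {n : Type*} [Fintype n] {M : Matrix n n ℂ} (hM : Mᵀ = M)
    (x y : EuclideanSpace ℂ n) :
    inner ℂ x (conjMulVec M y) = inner ℂ y (conjMulVec M x) := by
  have h : x.ofLp ⬝ᵥ M *ᵥ y.ofLp = y.ofLp ⬝ᵥ M *ᵥ x.ofLp := by
    rw [Matrix.dotProduct_mulVec, ← Matrix.mulVec_transpose, hM, dotProduct_comm]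
  simp only [EuclideanSpace.inner_eq_star_dotProduct, conjMulVec, LinearMap.coe_mk, AddHom.coe_mk]
  rw [Matrix.star_dotProduct_star, Matrix.star_dotProduct_star, h]

/-- Takagi factorization of a complex symmetric matrix. -/
theorem exists_takagi {n : Type*} [Fintype n] [DecidableEq n] {M : Matrix n n ℂ} (hM : Mᵀ = M)
    {k : ℕ} (hk : Fintype.card n = k) :
    ∃ (U : Matrix n (Fin k) ℂ) (l : Fin k → ℝ), Antitone l ∧ (∀ i, 0 ≤ l i) ∧ U * Uᴴ = 1 ∧
      Uᵀ * M * U = Matrix.diagonal fun i => (l i : ℂ) := by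
  obtain ⟨u, r, hu, hur⟩ := exists_orthonormal_eigenvectors_of_conjLinear (conjMulVec M)
    (conjMulVec_symm hM) k (by simp [hk])
  set σ := Tuple.sort (fun i => -r i)
  have hσ : Antitone (r ∘ σ) := fun i j hij => by
    simpa using Tuple.monotone_sort (fun i => -r i) hij
  have hu' : Orthonormal ℂ (u ∘ σ) := hu.comp _ σ.injective
  have hM' : ∀ i j, (M *ᵥ (u (σ j)).ofLp) i = r (σ j) * star (u (σ j) i) := fun i j => by
    have h := congrArg star (congrFun (congrArg WithLp.ofLp (hur (σ j)).2) i)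
    simpa [conjMulVec] using h
  have hin : ∀ i j, ∑ a, star (u (σ j) a) * u (σ i) a = if i = j then 1 else 0 := fun i j => by
    have h := orthonormal_iff_ite.1 hu' j i
    simp only [EuclideanSpace.inner_eq_star_dotProduct, dotProduct] at h
    rw [← if_congr (eq_comm (a := j) (b := i)) rfl rfl, ← h]
    exact Finset.sum_congr rfl fun a _ => by simp [mul_comm]
  refine ⟨Matrix.of fun i j => u (σ j) i, r ∘ σ, hσ, fun i => (hur _).1, ?_, ?_⟩
  · refine (Matrix.mul_eq_one_comm_of_card_eq _ _ _ (by simp [hk])).2 ?_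
    ext i j
    simp only [Matrix.mul_apply, Matrix.conjTranspose_apply, Matrix.of_apply, Matrix.one_apply]
    rw [hin, if_congr eq_comm rfl rfl]
  · ext i j
    rw [Matrix.mul_assoc, Matrix.mul_apply]
    have : ∀ a, (M * Matrix.of fun i j => u (σ j) i) a j = r (σ j) * star (u (σ j) a) :=
      fun a => hM' a j
    simp only [this, Matrix.transpose_apply, Matrix.of_apply, Matrix.diagonal_apply]
    have e : ∀ a, u (σ i) a * (r (σ j) * star (u (σ j) a)) =
      r (σ j) * (star (u (σ j) a) * u (σ i) a) := fun a => by ring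
    simp only [e]
    rw [← Finset.mul_sum, hin]
    split_ifs with h <;> simp [h]

theorem pauliY_kronecker_transpose : (pauliY ⊗ₖ pauliY)ᵀ = pauliY ⊗ₖ pauliY := by
  ext ⟨i, j⟩ ⟨k, l⟩
  fin_cases i <;> fin_cases j <;> fin_cases k <;> fin_cases l <;> simp [pauliY]

theorem pauliY_kronecker_conjTranspose : (pauliY ⊗ₖ pauliY)ᴴ = pauliY ⊗ₖ pauliY := by
  ext ⟨i, j⟩ ⟨k, l⟩
  fin_cases i <;> fin_cases j <;> fin_cases k <;> fin_cases l <;> simp [pauliY]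

/-- A positive semidefinite matrix factors as `B * Bᴴ` with the columns of `B` diagonalizing the
spin-flip form. -/
theorem exists_factor_spinFlip_diagonal {ρ : Matrix (Fin 2 × Fin 2) (Fin 2 × Fin 2) ℂ}
    (hρ : ρ.PosSemidef) :
    ∃ (B : Matrix (Fin 2 × Fin 2) (Fin 4) ℂ) (l : Fin 4 → ℝ), Antitone l ∧ (∀ i, 0 ≤ l i) ∧
      ρ = B * Bᴴ ∧ Bᵀ * (pauliY ⊗ₖ pauliY) * B = Matrix.diagonal fun i => (l i : ℂ) := by
  obtain ⟨A, hA⟩ : ∃ A : Matrix (Fin 2 × Fin 2) (Fin 2 × Fin 2) ℂ, ρ = A * Aᴴ := by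
    open scoped MatrixOrder Matrix.Norms.L2Operator in
    obtain ⟨C, hC⟩ := CStarAlgebra.nonneg_iff_eq_star_mul_self.mp hρ.nonneg
    exact ⟨Cᴴ, by rw [hC, Matrix.conjTranspose_conjTranspose, Matrix.star_eq_conjTranspose]⟩
  obtain ⟨U, l, hl, hl0, hU, hD⟩ := exists_takagi (M := Aᵀ * (pauliY ⊗ₖ pauliY) * A) (by
    rw [Matrix.transpose_mul, Matrix.transpose_mul, Matrix.transpose_transpose,
      pauliY_kronecker_transpose, Matrix.mul_assoc]) (k := 4) (by simp)
  refine ⟨A * U, l, hl, hl0, ?_, ?_⟩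
  · rw [Matrix.conjTranspose_mul, Matrix.mul_assoc, ← Matrix.mul_assoc U, hU, Matrix.one_mul, hA]
  · rw [← hD, Matrix.transpose_mul]
    simp only [Matrix.mul_assoc]

theorem woottersSpectrum_eq {ρ : Matrix (Fin 2 × Fin 2) (Fin 2 × Fin 2) ℂ}
    {B : Matrix (Fin 2 × Fin 2) (Fin 4) ℂ} {l : Fin 4 → ℝ} (hl : Antitone l) (hl0 : ∀ i, 0 ≤ l i)
    (hB : ρ = B * Bᴴ) (hD : Bᵀ * (pauliY ⊗ₖ pauliY) * B = Matrix.diagonal fun i => (l i : ℂ)) :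
    woottersSpectrum ρ = List.ofFn l := by
  have hflip : ρ * spinFlip ρ =
      B * ((Bᵀ * (pauliY ⊗ₖ pauliY) * B)ᴴ * (Bᵀ * (pauliY ⊗ₖ pauliY))) := by
    have h1 : ρ.map star = Bᵀᴴ * Bᵀ := by
      rw [hB]
      ext i j
      simp [Matrix.mul_apply, mul_comm]
    rw [spinFlip, h1, hB, Matrix.conjTranspose_mul, Matrix.conjTranspose_mul,
      pauliY_kronecker_conjTranspose]
    simp only [Matrix.mul_assoc]
  have hdiag : ((Bᵀ * (pauliY ⊗ₖ pauliY) * B)ᴴ * (Bᵀ * (pauliY ⊗ₖ pauliY))) * B =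
      Matrix.diagonal fun i => ((l i ^ 2 : ℝ) : ℂ) := by
    rw [Matrix.mul_assoc, hD, Matrix.diagonal_conjTranspose, Matrix.diagonal_mul_diagonal]
    congr 1
    ext i
    simp [sq]
  have hchar : (ρ * spinFlip ρ).charpoly.roots =
      Finset.univ.val.map fun i => ((l i ^ 2 : ℝ) : ℂ) := by
    rw [hflip, Matrix.charpoly_mul_comm_of_le _ _ (by simp), hdiag, Matrix.charpoly_diagonal]
    simp only [Fintype.card_fin, Fintype.card_prod, Nat.reduceMul, Nat.sub_self, pow_zero, one_mul]
    rw [← Polynomial.roots_multiset_prod_X_sub_C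
      (Finset.univ.val.map fun i => ((l i ^ 2 : ℝ) : ℂ)), Multiset.map_map]
    rfl
  have hmap : (ρ * spinFlip ρ).charpoly.roots.map (fun z => Real.sqrt z.re) =
      (List.ofFn l : Multiset ℝ) := by
    rw [hchar, Multiset.map_map, Fin.univ_val_map]
    congr 2
    ext i
    simp only [Function.comp, Complex.ofReal_re]
    exact Real.sqrt_sq (hl0 i)
  rw [woottersSpectrum, hmap, Multiset.coe_sort]
  exact List.mergeSort_eq_self _ (by
    rw [List.pairwise_ofFn]
    exact fun i j h => hl h.le)

theorem concurrence_eq {ρ : Matrix (Fin 2 × Fin 2) (Fin 2 × Fin 2) ℂ}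
    {B : Matrix (Fin 2 × Fin 2) (Fin 4) ℂ} {l : Fin 4 → ℝ} (hl : Antitone l) (hl0 : ∀ i, 0 ≤ l i)
    (hB : ρ = B * Bᴴ) (hD : Bᵀ * (pauliY ⊗ₖ pauliY) * B = Matrix.diagonal fun i => (l i : ℂ)) :
    concurrence ρ = max 0 (l 0 - l 1 - l 2 - l 3) := by
  rw [concurrence, woottersSpectrum_eq hl hl0 hB hD]
  simp [List.ofFn_succ]

/-- The spin-flip bilinear form `⟨φ*|σ_y ⊗ σ_y|φ⟩`. -/
def spinFlipForm (x : Fin 2 × Fin 2 → ℂ) : ℂ := x ⬝ᵥ ((pauliY ⊗ₖ pauliY) *ᵥ x)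

theorem spinFlipForm_eq (x : Fin 2 × Fin 2 → ℂ) :
    spinFlipForm x = 2 * (x (0, 1) * x (1, 0) - x (0, 0) * x (1, 1)) := by
  simp [spinFlipForm, dotProduct, Matrix.mulVec, Fintype.sum_prod_type, pauliY]
  ring_nf

theorem spinFlipForm_smul (c : ℂ) (x : Fin 2 × Fin 2 → ℂ) :
    spinFlipForm (c • x) = c ^ 2 * spinFlipForm x := by
  simp only [spinFlipForm_eq, Pi.smul_apply, smul_eq_mul]
  ring

/-- `tr (σ ^ ω)` for a Hermitian matrix is the sum of the powers of its eigenvalues. -/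
theorem traceRpow_eq_sum {n : Type} [Fintype n] [DecidableEq n] {σ : Matrix n n ℂ}
    (hσ : σ.IsHermitian) (ω : ℝ) : traceRpow ω σ = ∑ i, hσ.eigenvalues i ^ ω := by
  rw [traceRpow, hσ.cfc_eq, Matrix.IsHermitian.cfc, Unitary.conjStarAlgAut_apply,
    Matrix.trace_mul_comm, ← mul_assoc]
  simp [Matrix.trace, Complex.ofReal_re]

theorem gConcurrencePure_eq (ω : ℝ) {φ : Ket (Fin 2) (Fin 2)} (hφ : ‖φ‖ = 1) :
    ‖spinFlipForm φ.ofLp‖ ≤ 1 ∧ gConcurrencePure ω φ = hFun ω ‖spinFlipForm φ.ofLp‖ := by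
  have hσ : (partialTraceRight (ketBra φ)).IsHermitian := by
    ext i j
    simp [partialTraceRight, ketBra, mul_comm]
  set e := hσ.eigenvalues with he
  clear_value e
  have hnorm : ‖φ (0, 0)‖ ^ 2 + ‖φ (0, 1)‖ ^ 2 + ‖φ (1, 0)‖ ^ 2 + ‖φ (1, 1)‖ ^ 2 = 1 := by
    have := EuclideanSpace.norm_sq_eq φ
    rw [hφ, Fintype.sum_prod_type] at this
    simp at this
    linarith
  have hmul : ∀ z : ℂ, z * (starRingEnd ℂ) z = ((‖z‖ ^ 2 : ℝ) : ℂ) := fun z => by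
    rw [Complex.mul_conj, Complex.normSq_eq_norm_sq]
  have htr : e 0 + e 1 = 1 := by
    have h := hσ.trace_eq_sum_eigenvalues
    rw [← he, Fin.sum_univ_two] at h
    simp [Matrix.trace, partialTraceRight, ketBra] at h
    simp only [hmul] at h
    rw [← hnorm]
    norm_cast at h
    linarith
  have hdet : 4 * (e 0 * e 1) = ‖spinFlipForm φ.ofLp‖ ^ 2 := by
    have h := hσ.det_eq_prod_eigenvalues
    have h2 : ((4 * (e 0 * e 1) : ℝ) : ℂ) = ((‖spinFlipForm φ.ofLp‖ ^ 2 : ℝ) : ℂ) := by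
      rw [← hmul, spinFlipForm_eq]
      push_cast
      rw [← he, Fin.prod_univ_two] at h
      simp [Matrix.det_fin_two, partialTraceRight, ketBra] at h
      rw [← h]
      simp only [map_mul, map_sub, map_ofNat]
      ring
    exact_mod_cast h2
  set C := ‖spinFlipForm φ.ofLp‖ with hC
  have hC0 : 0 ≤ C := norm_nonneg _
  have hsq : 1 - C ^ 2 = (e 0 - e 1) ^ 2 := by
    rw [← hdet]
    linear_combination (-1 - e 0 - e 1) * htr
  refine ⟨by nlinarith [sq_nonneg (e 0 - e 1)], ?_⟩
  rw [gConcurrencePure, traceRpow_eq_sum hσ, hFun, hsq, Real.sqrt_sq_eq_abs, Fin.sum_univ_two,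
    ← he]
  congr 1
  obtain h | h := le_total 0 (e 0 - e 1)
  · rw [abs_of_nonneg h, show (1 + (e 0 - e 1)) / 2 = e 0 by linarith,
      show (1 - (e 0 - e 1)) / 2 = e 1 by linarith]
  · rw [abs_of_nonpos h, show (1 + -(e 0 - e 1)) / 2 = e 1 by linarith,
      show (1 - -(e 0 - e 1)) / 2 = e 0 by linarith, add_comm (e 0 ^ ω)]

theorem exists_mul_eq_of_mul_conjTranspose_eq {m n p : Type*} [Fintype m] [Fintype n] [Fintype p]
    {B : Matrix m n ℂ} {W : Matrix m p ℂ} (h : W * Wᴴ = B * Bᴴ) :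
    ∃ X : Matrix n p ℂ, W = B * X := by
  have key : ∀ i : p, (LinearMap.proj i ∘ₗ Wᴴ.mulVecLin) ∈ Submodule.span ℂ
      (Set.range fun k : n => (LinearMap.proj k ∘ₗ Bᴴ.mulVecLin)) := by
    intro i
    refine mem_span_of_iInf_ker_le_ker fun x hx => ?_
    have hx' : Bᴴ *ᵥ x = 0 := by
      ext k
      exact (Submodule.mem_iInf _).1 hx k
    have h2 : (W * Wᴴ) *ᵥ x = 0 := by
      rw [h, ← Matrix.mulVec_mulVec, hx', Matrix.mulVec_zero]
    rw [Matrix.self_mul_conjTranspose_mulVec_eq_zero] at h2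
    exact congrFun h2 i
  choose c hc using fun i => (Submodule.mem_span_range_iff_exists_fun ℂ).1 (key i)
  refine ⟨Matrix.of fun k i => star (c i k), ?_⟩
  classical
  ext a i
  have h1 := congrArg star (LinearMap.congr_fun (hc i) (Pi.single a 1))
  simp [Matrix.mul_apply] at h1 ⊢
  rw [← h1]
  exact Finset.sum_congr rfl fun k _ => mul_comm _ _

theorem sub_le_norm_sum_mul_sq {l : Fin 4 → ℝ} (hl0 : ∀ i, 0 ≤ l i) (x : Fin 4 → ℂ) :
    l 0 * ‖x 0‖ ^ 2 - l 1 * ‖x 1‖ ^ 2 - l 2 * ‖x 2‖ ^ 2 - l 3 * ‖x 3‖ ^ 2 ≤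
      ‖∑ k, (l k : ℂ) * x k ^ 2‖ := by
  have hn : ∀ k, ‖(l k : ℂ) * x k ^ 2‖ = l k * ‖x k‖ ^ 2 := fun k => by
    rw [norm_mul, norm_pow, Complex.norm_of_nonneg (hl0 k)]
  rw [Fin.sum_univ_four, ← hn, ← hn, ← hn, ← hn]
  generalize (l 0 : ℂ) * x 0 ^ 2 = a
  generalize (l 1 : ℂ) * x 1 ^ 2 = b
  generalize (l 2 : ℂ) * x 2 ^ 2 = c
  generalize (l 3 : ℂ) * x 3 ^ 2 = d
  have h1 := norm_add₃_le (a := a + b + c + d) (b := -b) (c := -c + -d)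
  rw [show a + b + c + d + -b + (-c + -d) = a by ring, norm_neg] at h1
  have h2 := norm_add_le (-c) (-d)
  rw [norm_neg, norm_neg] at h2
  linarith

/-- The difference of singular values bounds the total spin-flip overlap of any factorization. -/
theorem sub_le_sum_norm_spinFlipForm {ι : Type*} [Fintype ι]
    {B : Matrix (Fin 2 × Fin 2) (Fin 4) ℂ} {l : Fin 4 → ℝ} (hl0 : ∀ i, 0 ≤ l i)
    (hD : Bᵀ * (pauliY ⊗ₖ pauliY) * B = Matrix.diagonal fun i => (l i : ℂ))
    {W : Matrix (Fin 2 × Fin 2) ι ℂ} (hW : W * Wᴴ = B * Bᴴ) :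
    l 0 - l 1 - l 2 - l 3 ≤ ∑ i, ‖spinFlipForm (W.col i)‖ := by
  obtain ⟨X, rfl⟩ := exists_mul_eq_of_mul_conjTranspose_eq hW
  have hform : ∀ i, spinFlipForm ((B * X).col i) = ∑ k, (l k : ℂ) * X k i ^ 2 := by
    intro i
    have h1 : (B * X).col i = B *ᵥ X.col i := by
      ext a
      simp [Matrix.mul_apply, Matrix.mulVec, dotProduct]
    rw [spinFlipForm, h1, Matrix.mulVec_mulVec, ← Matrix.vecMul_transpose,
      ← Matrix.dotProduct_mulVec, Matrix.mulVec_mulVec, ← Matrix.mul_assoc, hD]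
    simp only [dotProduct, Matrix.mulVec_diagonal, Matrix.col_apply]
    exact Finset.sum_congr rfl fun k _ => by ring
  have hsum : ∀ k, ∑ i, l k * ‖X k i‖ ^ 2 = l k := by
    intro k
    set D : Matrix (Fin 4) (Fin 4) ℂ := Matrix.diagonal fun i => (l i : ℂ) with hDdef
    have h1 : (D * X) * (D * X)ᴴ = D * Dᴴ := by
      rw [← hD]
      calc Bᵀ * (pauliY ⊗ₖ pauliY) * B * X * (Bᵀ * (pauliY ⊗ₖ pauliY) * B * X)ᴴ
          = Bᵀ * (pauliY ⊗ₖ pauliY) * ((B * X) * (B * X)ᴴ) * (Bᵀ * (pauliY ⊗ₖ pauliY))ᴴ := by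
            simp only [Matrix.conjTranspose_mul, Matrix.mul_assoc]
        _ = _ := by
            rw [hW]
            simp only [Matrix.conjTranspose_mul, Matrix.mul_assoc]
    have h2 := congrFun (congrFun h1 k) k
    rw [hDdef, Matrix.diagonal_conjTranspose, Matrix.diagonal_mul_diagonal,
      Matrix.diagonal_apply_eq, Matrix.mul_apply] at h2
    simp only [Matrix.diagonal_mul, Matrix.conjTranspose_apply] at h2
    have h3 : ∀ i, (l k : ℂ) * X k i * star ((l k : ℂ) * X k i) =
        ((l k * (l k * ‖X k i‖ ^ 2) : ℝ) : ℂ) := fun i => by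
      have := Complex.mul_conj' (X k i)
      simp only [star_mul', RCLike.star_def, Complex.conj_ofReal]
      push_cast
      linear_combination (l k : ℂ) ^ 2 * this
    simp only [h3] at h2
    simp only [Pi.star_apply, RCLike.star_def, Complex.conj_ofReal] at h2
    norm_cast at h2
    rw [← Finset.mul_sum] at h2
    obtain h0 | h0 := eq_or_ne (l k) 0
    · simp [h0]
    · exact mul_left_cancel₀ h0 h2
  calc l 0 - l 1 - l 2 - l 3
      = ∑ i, (l 0 * ‖X 0 i‖ ^ 2 - l 1 * ‖X 1 i‖ ^ 2 - l 2 * ‖X 2 i‖ ^ 2 - l 3 * ‖X 3 i‖ ^ 2) := by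
        simp only [Finset.sum_sub_distrib, hsum]
    _ ≤ _ := Finset.sum_le_sum fun i _ => by
        rw [hform]
        exact sub_le_norm_sum_mul_sq hl0 fun k => X k i

/-- A real square matrix of trace zero is orthogonally similar to one with zero diagonal. -/
theorem exists_orthogonal_zero_diagonal {n : Type*} [Fintype n] [DecidableEq n]
    {X : Matrix n n ℝ} (hX : X.trace = 0) :
    ∃ O : Matrix n n ℝ, O * Oᵀ = 1 ∧ ∀ k, (Oᵀ * X * O) k k = 0 := by
  set g : (n → ℝ) → ℝ := fun v => v ⬝ᵥ X *ᵥ v with hg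
  have hsum : ∀ c : n → n → ℝ, ∑ k, Matrix.vecMulVec (c k) (c k) = 1 → ∑ k, g (c k) = 0 := by
    intro c hc
    have : ∀ k, g (c k) = (X * Matrix.vecMulVec (c k) (c k)).trace := fun k => by
      rw [Matrix.mul_vecMulVec, Matrix.trace_vecMulVec, dotProduct_comm]
    simp only [this]
    rw [← Matrix.trace_sum, ← Matrix.mul_sum, hc, Matrix.mul_one, hX]
  have main : ∀ N : ℕ, ∀ c : n → n → ℝ, ∑ k, Matrix.vecMulVec (c k) (c k) = 1 →
      (Finset.univ.filter fun k => g (c k) ≠ 0).card ≤ N →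
      ∃ c' : n → n → ℝ, ∑ k, Matrix.vecMulVec (c' k) (c' k) = 1 ∧ ∀ k, g (c' k) = 0 := by
    intro N
    induction N with
    | zero =>
      intro c hc hN
      refine ⟨c, hc, fun k => ?_⟩
      by_contra hk
      have : k ∈ Finset.univ.filter fun k => g (c k) ≠ 0 := by simpa using hk
      rw [Finset.card_eq_zero.1 (Nat.le_zero.1 hN)] at this
      simp at this
    | succ N ih =>
      intro c hc hN
      by_cases hall : ∀ k, g (c k) = 0
      · exact ⟨c, hc, hall⟩
      push Not at hall
      obtain ⟨k₀, hk₀⟩ := hall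
      obtain ⟨i, -, hi⟩ := Finset.exists_pos_of_sum_zero_of_exists_nonzero (fun k => g (c k))
        (hsum c hc) ⟨k₀, Finset.mem_univ _, hk₀⟩
      obtain ⟨j, -, hj⟩ := Finset.exists_pos_of_sum_zero_of_exists_nonzero (fun k => -g (c k))
        (by rw [Finset.sum_neg_distrib, hsum c hc, neg_zero])
        ⟨k₀, Finset.mem_univ _, neg_ne_zero.2 hk₀⟩
      have hij : i ≠ j := by
        rintro rfl
        linarith
      have hcont : Continuous fun t : ℝ => g (Real.cos t • c i + Real.sin t • c j) := by
        simp only [hg]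
        fun_prop
      obtain ⟨t, ht⟩ := mem_range_of_exists_le_of_exists_ge hcont (c := 0)
        ⟨Real.pi / 2, by simp; linarith⟩ ⟨0, by simpa using hi.le⟩
      set c' := Function.update (Function.update c i (Real.cos t • c i + Real.sin t • c j)) j
        (-Real.sin t • c i + Real.cos t • c j) with hc'
      have hc'i : c' i = Real.cos t • c i + Real.sin t • c j := by simp [hc', hij]
      have hc'j : c' j = -Real.sin t • c i + Real.cos t • c j := by simp [hc']
      have hc'k : ∀ k, k ≠ i → k ≠ j → c' k = c k := fun k h1 h2 => by simp [hc', h1, h2]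
      refine ih c' ?_ ?_
      · rw [← hc, ← sub_eq_zero, ← Finset.sum_sub_distrib, Fintype.sum_eq_add i j hij]
        · rw [hc'i, hc'j]
          ext a b
          simp [Matrix.vecMulVec_apply]
          linear_combination (c i a * c i b + c j a * c j b) * Real.sin_sq_add_cos_sq t
        · rintro k ⟨h1, h2⟩
          rw [hc'k k h1 h2, sub_self]
      · have hsub : (Finset.univ.filter fun k => g (c' k) ≠ 0) ⊆
            (Finset.univ.filter fun k => g (c k) ≠ 0).erase i := by
          intro k hk
          simp only [Finset.mem_filter, Finset.mem_univ, true_and, Finset.mem_erase] at hk ⊢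
          refine ⟨fun h => hk (by rw [h, hc'i]; exact ht), ?_⟩
          by_cases hkj : k = j
          · rw [hkj]
            linarith
          · rwa [hc'k k (fun h => hk (by rw [h, hc'i]; exact ht)) hkj] at hk
        have hmem : i ∈ Finset.univ.filter fun k => g (c k) ≠ 0 := by
          simpa using hi.ne'
        have := Finset.card_le_card hsub
        rw [Finset.card_erase_of_mem hmem] at this
        omega
  obtain ⟨c, hc, hc0⟩ := main _ (fun k => Pi.single k 1) (by
    ext a b
    simp [Matrix.sum_apply, Matrix.vecMulVec_apply, Pi.single_apply, Matrix.one_apply]) le_rfl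
  refine ⟨Matrix.of fun a k => c k a, ?_, fun k => ?_⟩
  · rw [← hc]
    ext a b
    simp [Matrix.mul_apply, Matrix.sum_apply, Matrix.vecMulVec_apply]
  · rw [← hc0 k, hg, Matrix.mul_assoc, Matrix.mul_apply]
    rfl

theorem exists_phase_norm_add_eq {a b r : ℝ} (h₁ : |a - b| ≤ r) (h₂ : r ≤ a + b) :
    ∃ θ : ℝ, ‖(a : ℂ) + b * Complex.exp (θ * Complex.I)‖ = r := by
  have hcont : Continuous fun θ : ℝ => ‖(a : ℂ) + b * Complex.exp (θ * Complex.I)‖ := by fun_prop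
  refine mem_range_of_exists_le_of_exists_ge hcont ⟨Real.pi, ?_⟩ ⟨0, ?_⟩
  · simp only [Complex.exp_pi_mul_I]
    rw [show (a : ℂ) + b * -1 = ((a - b : ℝ) : ℂ) by push_cast; ring, Complex.norm_real]
    exact h₁
  · simp only [Complex.ofReal_zero, zero_mul, Complex.exp_zero, mul_one]
    rw [← Complex.ofReal_add, Complex.norm_real]
    exact h₂.trans (le_abs_self _)

theorem exists_phase_add_eq_zero {u v : ℂ} (h : ‖u‖ = ‖v‖) :
    ∃ θ : ℝ, u + Complex.exp (θ * Complex.I) * v = 0 := by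
  refine ⟨u.arg - v.arg + Real.pi, ?_⟩
  have hu := Complex.norm_mul_exp_arg_mul_I u
  have hv := Complex.norm_mul_exp_arg_mul_I v
  have h' : (‖u‖ : ℂ) = ‖v‖ := congrArg _ h
  have key : Complex.exp ((u.arg - v.arg + Real.pi : ℝ) * Complex.I) *
      Complex.exp (v.arg * Complex.I) = -Complex.exp (u.arg * Complex.I) := by
    rw [← Complex.exp_add, show ((u.arg - v.arg + Real.pi : ℝ) : ℂ) * Complex.I +
      v.arg * Complex.I = u.arg * Complex.I + Real.pi * Complex.I by push_cast; ring,
      Complex.exp_add, Complex.exp_pi_mul_I, mul_neg_one]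
  linear_combination -hu - Complex.exp ((u.arg - v.arg + Real.pi : ℝ) * Complex.I) * hv +
    (‖v‖ : ℂ) * key + Complex.exp (u.arg * Complex.I) * h'

/-- Four lengths, none exceeding the sum of the others, close up to a polygon. -/
theorem exists_phases_sum_eq_zero {l : Fin 4 → ℝ} (hl : Antitone l) (hl0 : ∀ i, 0 ≤ l i)
    (h : l 0 ≤ l 1 + l 2 + l 3) :
    ∃ θ : Fin 4 → ℝ, ∑ k, (l k : ℂ) * Complex.exp (θ k * Complex.I) = 0 := by
  have h01 := hl (show (0 : Fin 4) ≤ 1 by decide)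
  have h12 := hl (show (1 : Fin 4) ≤ 2 by decide)
  have h23 := hl (show (2 : Fin 4) ≤ 3 by decide)
  have h3 := hl0 3
  set r := max (l 0 - l 1) (l 2 - l 3) with hr
  obtain ⟨α, hα⟩ := exists_phase_norm_add_eq (a := l 0) (b := l 1) (r := r)
    (by rw [abs_of_nonneg (by linarith)]; exact le_max_left _ _)
    (max_le (by linarith) (by linarith))
  obtain ⟨β, hβ⟩ := exists_phase_norm_add_eq (a := l 2) (b := l 3) (r := r)
    (by rw [abs_of_nonneg (by linarith)]; exact le_max_right _ _)
    (max_le (by linarith) (by linarith))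
  obtain ⟨γ, hγ⟩ := exists_phase_add_eq_zero (hα.trans hβ.symm)
  refine ⟨![0, α, γ, γ + β], ?_⟩
  rw [Fin.sum_univ_four, ← hγ]
  simp [add_mul, Complex.exp_add]
  ring

theorem spinFlipForm_col {p : Type*} [Fintype p] (W : Matrix (Fin 2 × Fin 2) p ℂ) (k : p) :
    spinFlipForm (W.col k) = (Wᵀ * (pauliY ⊗ₖ pauliY) * W) k k := by
  rw [Matrix.mul_assoc, Matrix.mul_apply]
  rfl

theorem mul_mul_conjTranspose_of_unitary {m n p : Type*} [Fintype n] [Fintype p] [DecidableEq n]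
    (B : Matrix m n ℂ) {Z : Matrix n p ℂ} (hZ : Z * Zᴴ = 1) : (B * Z) * (B * Z)ᴴ = B * Bᴴ := by
  rw [Matrix.conjTranspose_mul, Matrix.mul_assoc, ← Matrix.mul_assoc Z, hZ, Matrix.one_mul]

theorem diagonal_phases_unitary {n : Type*} [Fintype n] [DecidableEq n] {ζ : n → ℂ}
    (hζ : ∀ k, ‖ζ k‖ = 1) : Matrix.diagonal ζ * (Matrix.diagonal ζ)ᴴ = 1 := by
  rw [Matrix.diagonal_conjTranspose, Matrix.diagonal_mul_diagonal, ← Matrix.diagonal_one]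
  congr 1
  ext k
  simp [Complex.mul_conj', hζ]

theorem transpose_diagonal_conj {B : Matrix (Fin 2 × Fin 2) (Fin 4) ℂ} {l : Fin 4 → ℝ}
    (hD : Bᵀ * (pauliY ⊗ₖ pauliY) * B = Matrix.diagonal fun i => (l i : ℂ)) (ζ : Fin 4 → ℂ) :
    (B * Matrix.diagonal ζ)ᵀ * (pauliY ⊗ₖ pauliY) * (B * Matrix.diagonal ζ) =
      Matrix.diagonal fun i => l i * ζ i ^ 2 := by
  have : (B * Matrix.diagonal ζ)ᵀ * (pauliY ⊗ₖ pauliY) * (B * Matrix.diagonal ζ) =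
      Matrix.diagonal ζ * (Bᵀ * (pauliY ⊗ₖ pauliY) * B) * Matrix.diagonal ζ := by
    rw [Matrix.transpose_mul, Matrix.diagonal_transpose]
    simp only [Matrix.mul_assoc]
  rw [this, hD, Matrix.diagonal_mul_diagonal, Matrix.diagonal_mul_diagonal]
  congr 1
  ext i
  ring

/-- The real `4 × 4` Hadamard matrix, normalized to be orthogonal. -/
def hadamardFour : Matrix (Fin 4) (Fin 4) ℂ :=
  Matrix.of ![![1 / 2, 1 / 2, 1 / 2, 1 / 2], ![1 / 2, -1 / 2, 1 / 2, -1 / 2],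
    ![1 / 2, 1 / 2, -1 / 2, -1 / 2], ![1 / 2, -1 / 2, -1 / 2, 1 / 2]]

theorem hadamardFour_unitary : hadamardFour * hadamardFourᴴ = 1 := by
  ext i j
  rw [Matrix.mul_apply, Fin.sum_univ_four]
  fin_cases i <;> fin_cases j <;> simp [hadamardFour] <;> norm_num

theorem hadamardFour_sq (i j : Fin 4) : hadamardFour i j ^ 2 = 1 / 4 := by
  fin_cases i <;> fin_cases j <;> simp [hadamardFour] <;> norm_num

theorem diag_transpose_diagonal_mul {n p : Type*} [Fintype n] [Fintype p] [DecidableEq n]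
    {R : Type*} [CommRing R] (d : n → R) (Z : Matrix n p R) (k : p) :
    (Zᵀ * Matrix.diagonal d * Z) k k = ∑ j, d j * Z j k ^ 2 := by
  rw [Matrix.mul_apply]
  simp only [Matrix.mul_diagonal, Matrix.transpose_apply]
  exact Finset.sum_congr rfl fun j _ => by ring

/-- Wootters' decomposition, all of whose members have the same concurrence. -/
theorem exists_factor_norm_spinFlipForm_eq {B : Matrix (Fin 2 × Fin 2) (Fin 4) ℂ} {l : Fin 4 → ℝ}
    (hl : Antitone l) (hl0 : ∀ i, 0 ≤ l i)
    (hD : Bᵀ * (pauliY ⊗ₖ pauliY) * B = Matrix.diagonal fun i => (l i : ℂ))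
    (htr : (B * Bᴴ).trace = 1) :
    ∃ W : Matrix (Fin 2 × Fin 2) (Fin 4) ℂ, W * Wᴴ = B * Bᴴ ∧ ∀ k,
      ‖spinFlipForm (W.col k)‖ = max 0 (l 0 - l 1 - l 2 - l 3) * ∑ a, ‖W a k‖ ^ 2 := by
  obtain h | h := le_total (l 0 - l 1 - l 2 - l 3) 0
  · obtain ⟨θ, hθ⟩ := exists_phases_sum_eq_zero hl hl0 (by linarith)
    set ζ : Fin 4 → ℂ := fun k => Complex.exp ((θ k / 2 : ℝ) * Complex.I) with hζ
    have hζ2 : ∀ k, ζ k ^ 2 = Complex.exp (θ k * Complex.I) := fun k => by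
      rw [hζ, ← Complex.exp_nat_mul]
      congr 1
      push_cast
      ring
    refine ⟨B * Matrix.diagonal ζ * hadamardFour, ?_, fun k => ?_⟩
    · rw [mul_mul_conjTranspose_of_unitary _ hadamardFour_unitary,
        mul_mul_conjTranspose_of_unitary _ (diagonal_phases_unitary fun k =>
          Complex.norm_exp_ofReal_mul_I _)]
    · have e : (B * Matrix.diagonal ζ * hadamardFour)ᵀ * (pauliY ⊗ₖ pauliY) *
          (B * Matrix.diagonal ζ * hadamardFour) = hadamardFourᵀ *
          ((B * Matrix.diagonal ζ)ᵀ * (pauliY ⊗ₖ pauliY) * (B * Matrix.diagonal ζ)) *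
          hadamardFour := by
        rw [Matrix.transpose_mul _ hadamardFour]
        simp only [Matrix.mul_assoc]
      rw [max_eq_left h, zero_mul, spinFlipForm_col, e, transpose_diagonal_conj hD,
        diag_transpose_diagonal_mul]
      simp only [hadamardFour_sq, hζ2]
      rw [← Finset.sum_mul, hθ, zero_mul, norm_zero]
  · set C := l 0 - l 1 - l 2 - l 3 with hC
    set ζ : Fin 4 → ℂ := ![1, Complex.I, Complex.I, Complex.I] with hζ
    set d : Fin 4 → ℝ := ![l 0, -l 1, -l 2, -l 3] with hd
    have hζ1 : ∀ k, ‖ζ k‖ = 1 := fun k => by fin_cases k <;> simp [hζ]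
    have hdζ : ∀ k, (l k : ℂ) * ζ k ^ 2 = (d k : ℂ) := fun k => by
      fin_cases k <;> simp [hζ, hd]
    set B' := B * Matrix.diagonal ζ with hB'
    have hBB : B' * B'ᴴ = B * Bᴴ :=
      mul_mul_conjTranspose_of_unitary _ (diagonal_phases_unitary hζ1)
    have hD' : B'ᵀ * (pauliY ⊗ₖ pauliY) * B' = Matrix.diagonal fun i => (d i : ℂ) := by
      rw [hB', transpose_diagonal_conj hD]
      congr 1
      ext i
      exact hdζ i
    set G : Matrix (Fin 4) (Fin 4) ℝ := (B'ᴴ * B').map Complex.re with hG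
    have hGtr : G.trace = 1 := by
      have h1 : (B'ᴴ * B').trace = 1 := by rw [Matrix.trace_mul_comm, hBB, htr]
      have h2 := congrArg Complex.re h1
      simpa [Matrix.trace, hG] using h2
    obtain ⟨O, hO, hO0⟩ := exists_orthogonal_zero_diagonal (X := Matrix.diagonal d - C • G) (by
      rw [Matrix.trace_sub, Matrix.trace_smul, hGtr, Matrix.trace_diagonal, Fin.sum_univ_four]
      simp [hd, hC]
      ring)
    set Z : Matrix (Fin 4) (Fin 4) ℂ := O.map Complex.ofReal with hZ
    have hZ1 : Z * Zᴴ = 1 := by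
      ext i j
      have := congrFun (congrFun hO i) j
      simp only [Matrix.mul_apply, Matrix.transpose_apply, Matrix.conjTranspose_apply, hZ,
        Matrix.map_apply, RCLike.star_def, Complex.conj_ofReal, Matrix.one_apply] at this ⊢
      rw [← Complex.ofReal_one, ← Complex.ofReal_zero, ← apply_ite Complex.ofReal, ← this]
      push_cast
      rfl
    refine ⟨B' * Z, by rw [mul_mul_conjTranspose_of_unitary _ hZ1, hBB], fun k => ?_⟩
    have hnorm : ∑ a, ‖(B' * Z) a k‖ ^ 2 = (Oᵀ * G * O) k k := by
      have h1 : ((B' * Z)ᴴ * (B' * Z)) k k = ((∑ a, ‖(B' * Z) a k‖ ^ 2 : ℝ) : ℂ) := by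
        rw [Matrix.mul_apply]
        simp only [Matrix.conjTranspose_apply, RCLike.star_def, Complex.conj_mul']
        push_cast
        rfl
      have h2 : ((B' * Z)ᴴ * (B' * Z)) = Zᴴ * (B'ᴴ * B') * Z := by
        rw [Matrix.conjTranspose_mul]
        simp only [Matrix.mul_assoc]
      rw [h2] at h1
      have h3 := congrArg Complex.re h1
      rw [Complex.ofReal_re] at h3
      rw [← h3, Matrix.mul_apply, Matrix.mul_apply, Complex.re_sum]
      refine Finset.sum_congr rfl fun i _ => ?_
      rw [Matrix.mul_apply, Matrix.mul_apply]
      simp [hZ, hG, Complex.re_sum]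
    have hform : spinFlipForm ((B' * Z).col k) = ((Oᵀ * Matrix.diagonal d * O) k k : ℝ) := by
      have e : (B' * Z)ᵀ * (pauliY ⊗ₖ pauliY) * (B' * Z) =
          Zᵀ * (B'ᵀ * (pauliY ⊗ₖ pauliY) * B') * Z := by
        rw [Matrix.transpose_mul]
        simp only [Matrix.mul_assoc]
      rw [spinFlipForm_col, e, hD', diag_transpose_diagonal_mul, diag_transpose_diagonal_mul]
      simp [hZ]
    have h0 := hO0 k
    rw [Matrix.mul_sub, Matrix.sub_mul, Matrix.mul_smul, Matrix.smul_mul, Matrix.sub_apply,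
      Matrix.smul_apply, sub_eq_zero, ← hnorm] at h0
    rw [hform, h0, max_eq_right h, Complex.norm_real, smul_eq_mul]
    exact Real.norm_of_nonneg (mul_nonneg h (Finset.sum_nonneg fun _ _ => by positivity))

/-- The matrix whose columns are the vectors of a decomposition, scaled by root weights. -/
def decompositionMatrix {a b : Type} {n : ℕ} (p : Fin n → ℝ) (φ : Fin n → Ket a b) :
    Matrix (a × b) (Fin n) ℂ :=
  Matrix.of fun x i => (Real.sqrt (p i) : ℂ) * φ i x

theorem decompositionMatrix_mul_conjTranspose {a b : Type} [Fintype a] [Fintype b] {n : ℕ}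
    {ρ : Matrix (a × b) (a × b) ℂ} {p : Fin n → ℝ} {φ : Fin n → Ket a b}
    (h : IsPureDecomposition ρ p φ) :
    decompositionMatrix p φ * (decompositionMatrix p φ)ᴴ = ρ := by
  rw [h.2.2.2]
  ext x y
  rw [Matrix.mul_apply, Matrix.sum_apply]
  refine Finset.sum_congr rfl fun i _ => ?_
  have hp : (Real.sqrt (p i) : ℂ) * Real.sqrt (p i) = p i := by
    rw [← Complex.ofReal_mul, Real.mul_self_sqrt (h.1 i)]
  simp only [decompositionMatrix, Matrix.conjTranspose_apply, Matrix.of_apply, star_mul',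
    Matrix.smul_apply, ketBra, smul_eq_mul, RCLike.star_def, Complex.conj_ofReal]
  linear_combination (φ i x * (starRingEnd ℂ) (φ i y)) * hp

theorem norm_spinFlipForm_decompositionMatrix {n : ℕ} {p : Fin n → ℝ}
    {φ : Fin n → Ket (Fin 2) (Fin 2)} {i : Fin n} (hp : 0 ≤ p i) :
    ‖spinFlipForm ((decompositionMatrix p φ).col i)‖ = p i * ‖spinFlipForm (φ i).ofLp‖ := by
  have h : (decompositionMatrix p φ).col i = (Real.sqrt (p i) : ℂ) • (φ i).ofLp := rfl
  rw [h, spinFlipForm_smul, norm_mul, ← Complex.ofReal_pow, Real.sq_sqrt hp,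
    Complex.norm_of_nonneg hp]

/-- Any factorization `ρ = W * Wᴴ` of a density matrix gives a pure-state decomposition. -/
theorem exists_decomposition_of_factor {ρ : Matrix (Fin 2 × Fin 2) (Fin 2 × Fin 2) ℂ}
    (hρ : ρ.trace = 1) {n : ℕ} {W : Matrix (Fin 2 × Fin 2) (Fin n) ℂ} (hW : W * Wᴴ = ρ) {c : ℝ}
    (hc : ∀ k, ‖spinFlipForm (W.col k)‖ = c * ∑ a, ‖W a k‖ ^ 2) :
    ∃ (p : Fin n → ℝ) (φ : Fin n → Ket (Fin 2) (Fin 2)), IsPureDecomposition ρ p φ ∧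
      ∀ k, p k ≠ 0 → ‖spinFlipForm (φ k).ofLp‖ = c := by
  set w : Fin n → Ket (Fin 2) (Fin 2) := fun k => WithLp.toLp 2 (W.col k) with hw
  have hwn : ∀ k, ‖w k‖ ^ 2 = ∑ a, ‖W a k‖ ^ 2 := fun k => EuclideanSpace.norm_sq_eq _
  set φ : Fin n → Ket (Fin 2) (Fin 2) := fun k =>
    if w k = 0 then EuclideanSpace.single (0, 0) 1 else ((‖w k‖⁻¹ : ℝ) : ℂ) • w k with hφ
  have hwφ : ∀ k, w k = (‖w k‖ : ℂ) • φ k := fun k => by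
    by_cases h : w k = 0
    · simp [h]
    · have h' : (‖w k‖ : ℂ) ≠ 0 := by simpa using h
      simp only [hφ, h, if_false, smul_smul]
      rw [Complex.ofReal_inv, mul_inv_cancel₀ h', one_smul]
  refine ⟨fun k => ‖w k‖ ^ 2, φ, ⟨fun k => by positivity, ?_, fun k => ?_, ?_⟩, fun k hk => ?_⟩
  · have h1 : ((∑ k, ‖w k‖ ^ 2 : ℝ) : ℂ) = ρ.trace := by
      rw [← hW, Matrix.trace]
      simp only [Matrix.diag_apply, Matrix.mul_apply, Matrix.conjTranspose_apply, RCLike.star_def,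
        Complex.mul_conj', hwn]
      rw [Finset.sum_comm]
      push_cast
      rfl
    rw [hρ] at h1
    exact_mod_cast h1
  · by_cases h : w k = 0
    · simp [hφ, h]
    · simp only [hφ, h, if_false, norm_smul]
      simp [h]
  · rw [← hW]
    ext x y
    rw [Matrix.mul_apply, Matrix.sum_apply]
    refine Finset.sum_congr rfl fun k _ => ?_
    have hx : ∀ x, W x k = (‖w k‖ : ℂ) * φ k x := fun x =>
      congrFun (congrArg WithLp.ofLp (hwφ k)) x
    rw [Matrix.conjTranspose_apply, hx, hx]
    simp only [ketBra, Matrix.smul_apply, Matrix.of_apply, star_mul', RCLike.star_def,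
      Complex.conj_ofReal, smul_eq_mul]
    push_cast
    ring
  · have h1 := hc k
    have h2 : W.col k = (‖w k‖ : ℂ) • (φ k).ofLp := congrArg WithLp.ofLp (hwφ k)
    rw [h2, spinFlipForm_smul, norm_mul, ← Complex.ofReal_pow,
      Complex.norm_of_nonneg (by positivity), ← hwn, mul_comm] at h1
    exact mul_right_cancel₀ hk h1

/-- Wootters' formula: the concurrence bounds every average pure-state concurrence from below, and
some decomposition has all its pure-state concurrences equal to it. -/
theorem concurrence_roof {ρ : Matrix (Fin 2 × Fin 2) (Fin 2 × Fin 2) ℂ}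
    (hρ : IsDensityMatrix ρ) :
    (∀ (n : ℕ) (p : Fin n → ℝ) (φ : Fin n → Ket (Fin 2) (Fin 2)), IsPureDecomposition ρ p φ →
      concurrence ρ ≤ ∑ i, p i * ‖spinFlipForm (φ i).ofLp‖) ∧
    ∃ (p : Fin 4 → ℝ) (φ : Fin 4 → Ket (Fin 2) (Fin 2)), IsPureDecomposition ρ p φ ∧
      ∀ k, p k ≠ 0 → ‖spinFlipForm (φ k).ofLp‖ = concurrence ρ := by
  obtain ⟨B, l, hl, hl0, hB, hD⟩ := exists_factor_spinFlip_diagonal hρ.1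
  rw [concurrence_eq hl hl0 hB hD]
  constructor
  · intro n p φ h
    refine max_le (Finset.sum_nonneg fun i _ => mul_nonneg (h.1 i) (norm_nonneg _)) ?_
    have := sub_le_sum_norm_spinFlipForm hl0 hD
      ((decompositionMatrix_mul_conjTranspose h).trans hB)
    simpa only [norm_spinFlipForm_decompositionMatrix (h.1 _)] using this
  · obtain ⟨W, hW, hWc⟩ := exists_factor_norm_spinFlipForm_eq hl hl0 hD (hB ▸ hρ.2)
    exact exists_decomposition_of_factor hρ.2 (hW.trans hB.symm) hWc

end

theorem theorem1 (ω : ℝ) (hω₀ : 0.85798 ≤ ω) (hω₁ : ω ≤ 1)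
    (ρ : Matrix (Fin 2 × Fin 2) (Fin 2 × Fin 2) ℂ) (hρ : IsDensityMatrix ρ) :
    concurrence ρ ∈ Set.Icc (0 : ℝ) 1 ∧
      IsLeast (gConcurrenceValues ω ρ) (gConcurrence ω ρ) ∧
      gConcurrence ω ρ = hFun ω (concurrence ρ) := by
  obtain ⟨hlow, p, φ, hdec, hopt⟩ := concurrence_roof hρ
  have hC : concurrence ρ ∈ Set.Icc (0 : ℝ) 1 := by
    refine ⟨le_max_left _ _, (hlow _ p φ hdec).trans ?_⟩
    rw [← hdec.2.1]
    exact Finset.sum_le_sum fun i _ => mul_le_of_le_one_right (hdec.1 i)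
      (gConcurrencePure_eq ω (hdec.2.2.1 i)).1
  have hleast : IsLeast (gConcurrenceValues ω ρ) (hFun ω (concurrence ρ)) := by
    constructor
    · refine ⟨4, p, φ, hdec, ?_⟩
      have : ∀ i, p i * gConcurrencePure ω (φ i) = p i * hFun ω (concurrence ρ) := fun i => by
        by_cases hi : p i = 0
        · rw [hi, zero_mul, zero_mul]
        · rw [(gConcurrencePure_eq ω (hdec.2.2.1 i)).2, hopt i hi]
      simp only [this]
      rw [← Finset.sum_mul, hdec.2.1, one_mul]
    · rintro v ⟨n, q, ψ, hq, rfl⟩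
      have hmem : ∀ i, ‖spinFlipForm (ψ i).ofLp‖ ∈ Set.Icc (0 : ℝ) 1 := fun i =>
        ⟨norm_nonneg _, (gConcurrencePure_eq ω (hq.2.2.1 i)).1⟩
      have hconv := convexOn_hFun hω₀ hω₁
      have hjensen := hconv.map_sum_le (t := Finset.univ) (w := q)
        (p := fun i => ‖spinFlipForm (ψ i).ofLp‖) (fun i _ => hq.1 i) hq.2.1 fun i _ => hmem i
      have hmean := (convex_Icc (0 : ℝ) 1).sum_mem (t := Finset.univ) (w := q)
        (fun i _ => hq.1 i) hq.2.1 fun i _ => hmem i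
      simp only [smul_eq_mul] at hjensen hmean
      have hmono := monotoneOn_hFun (by linarith) hω₁ hC hmean (hlow n q ψ hq)
      simp only [(gConcurrencePure_eq ω (hq.2.2.1 _)).2]
      exact hmono.trans hjensen
  have heq : gConcurrence ω ρ = hFun ω (concurrence ρ) := hleast.csInf_eq
  exact ⟨hC, heq ▸ hleast, heq⟩
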